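/- Let $(a,b)\subseteq\mathbb{R}$ be a nonempty open interval, $-\infty\le a<b\le\infty$, and let $p,q,r,s$ be Lebesgue measurable real-valued functions on $(a,b)$ with $p^{-1},q,r,s\in L^1_{\mathrm{loc}}((a,b);dx)$, $r>0$ a.e. and $p\neq 0$ a.e. on $(a,b)$. Let $\mathfrak{D}_\tau$ be the set of all $f\in AC_{\mathrm{loc}}((a,b))$ such that $f^{[1]}:=p\,[f'+sf]$ belongs to $AC_{\mathrm{loc}}((a,b))$ (that is, agrees a.e. with such a function), and for $f\in\mathfrak{D}_\tau$ put $$\tau f=\frac1r\Big(-\big(f^{[1]}\big)'+s f^{[1]}+qf\Big).$$ In the complex Hilbert space $L^2((a,b);r(x)\,dx)$ with inner product $\langle\cdot,\cdot\rangle_r$, let $T_{\max}f=\tau f$ on $\operatorname{dom}(T_{\max})=\{g\in L^2((a,b);r\,dx): g\in\mathfrak{D}_\tau,\ \tau g\in L^2((a,b);r\,dx)\}$, let $T_0$ be the restriction of $T_{\max}$ to the functions in $\operatorname{dom}(T_{\max})$ with compact support in $(a,b)$, and let $T_{\min}=\overline{T_0}$ be the closure of $T_0$. For $\lambda\in\mathbb{R}$,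 the expression $\tau-\lambda$ is called oscillatory at $a$ (resp. $b$) if some nontrivial real-valued solution $u\in\mathfrak{D}_\tau$ of $-(u^{[1]})'+su^{[1]}+qu=\lambda ur$ has infinitely many zeros accumulating at $a$ (resp. $b$), and non-oscillatory at $a$ (resp. $b$) otherwise. Suppose that $p>0$ a.e. on $(a,b)$ and that there exist $\lambda_a,\lambda_b\in\mathbb{R}$ such that $\tau-\lambda_a$ is non-oscillatory at $a$ and $\tau-\lambda_b$ is non-oscillatory at $b$. Then $T_0$ is bounded from below, and so is every self-adjoint extension $S$ of $T_{\min}$. That is, there exists $\gamma_0\in\mathbb{R}$ with $\langle u,T_0u\rangle_r\ge\gamma_0\langle u,u\rangle_r$ for all $u\in\operatorname{dom}(T_0)$, and for every self-adjoint extension $S$ of $T_{\min}$ there exists $\gamma_S\in\mathbb{R}$ such that $$\langle u,Su\rangle_r\ge\gamma_S\langle u,u\rangle_r,\qquad u\in\operatorname{dom}(S).$$ -/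

import Mathlib

open MeasureTheory Set

noncomputable section

/-- The data of a Sturm--Liouville differential expression with four coefficients
`τ f = r⁻¹ (-(f^[1])' + s f^[1] + q f)`, `f^[1] = p (f' + s f)`, on an open interval `(a, b)` whose
endpoints may be infinite. The coefficients only matter on `(a, b)`. -/
structure SLExpr where
  a : EReal
  b : EReal
  p : ℝ → ℝ
  q : ℝ → ℝ
  r : ℝ → ℝ
  s : ℝ → ℝ

namespace SLExpr

/-- The interval `(a, b)`, as a set of real numbers. -/
def I (τ : SLExpr) : Set ℝ := {x : ℝ | τ.a < (x : EReal) ∧ (x : EReal) < τ.b}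

/-- The standing assumptions: `(a, b)` is a nonempty open interval, the (real-valued) coefficients
are Lebesgue measurable on it, `p⁻¹, q, r, s ∈ L¹_loc((a, b); dx)`, and `r > 0`, `p ≠ 0` a.e. -/
structure Hypothesis (τ : SLExpr) : Prop where
  a_lt_b : τ.a < τ.b
  p_meas : AEMeasurable τ.p (volume.restrict τ.I)
  q_meas : AEMeasurable τ.q (volume.restrict τ.I)
  r_meas : AEMeasurable τ.r (volume.restrict τ.I)
  s_meas : AEMeasurable τ.s (volume.restrict τ.I)
  p_inv_loc : LocallyIntegrableOn (fun x => (τ.p x)⁻¹) τ.I volume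
  q_loc : LocallyIntegrableOn τ.q τ.I volume
  r_loc : LocallyIntegrableOn τ.r τ.I volume
  s_loc : LocallyIntegrableOn τ.s τ.I volume
  r_pos : ∀ᵐ x ∂(volume.restrict τ.I), 0 < τ.r x
  p_ne : ∀ᵐ x ∂(volume.restrict τ.I), τ.p x ≠ 0

section Functions

variable {E : Type*} [NormedAddCommGroup E] [NormedSpace ℝ E]

/-- `f ∈ AC_loc((a, b))`: absolutely continuous on every compact subinterval of `(a, b)`. -/
def ACLoc (τ : SLExpr) (f : ℝ → E) : Prop :=
  ∀ x ∈ τ.I, ∀ y ∈ τ.I, AbsolutelyContinuousOnInterval f x y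

/-- `f` belongs to `𝔇_τ` and `f₁` is its first quasi-derivative: `f ∈ AC_loc((a, b))`, and
`f₁ ∈ AC_loc((a, b))` is the (unique) continuous representative of `p (f' + s f)`. -/
structure HasQuasiDeriv (τ : SLExpr) (f f₁ : ℝ → E) : Prop where
  acLoc : τ.ACLoc f
  acLoc_quasi : τ.ACLoc f₁
  eq_ae : ∀ᵐ x ∂(volume.restrict τ.I), f₁ x = τ.p x • (deriv f x + τ.s x • f x)

/-- The function `τ f = r⁻¹ (-(f^[1])' + s f^[1] + q f)`, where `f₁ = f^[1]`. -/
def apply (τ : SLExpr) (f f₁ : ℝ → E) (x : ℝ) : E :=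
  (τ.r x)⁻¹ • (-deriv f₁ x + τ.s x • f₁ x + τ.q x • f x)

end Functions

/-- `u` is a real-valued solution in `𝔇_τ` of `-(u^[1])' + s u^[1] + q u = lam u r`
a.e. on `(a, b)`. -/
def IsRealSolution (τ : SLExpr) (lam : ℝ) (u : ℝ → ℝ) : Prop :=
  ∃ u₁ : ℝ → ℝ, τ.HasQuasiDeriv u u₁ ∧
    ∀ᵐ x ∂(volume.restrict τ.I),
      -deriv u₁ x + τ.s x * u₁ x + τ.q x * u x = lam * u x * τ.r x

/-- `τ - lam` is oscillatory at `a`: some nontrivial real-valued solution has zeros in `(a, b)`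
arbitrarily close to `a` (hence infinitely many zeros accumulating at `a ∉ (a, b)`). -/
def OscillatoryAtLeft (τ : SLExpr) (lam : ℝ) : Prop :=
  ∃ u : ℝ → ℝ, τ.IsRealSolution lam u ∧ (∃ x ∈ τ.I, u x ≠ 0) ∧
    ∀ c ∈ τ.I, ∃ x ∈ τ.I, x < c ∧ u x = 0

/-- `τ - lam` is oscillatory at `b`. -/
def OscillatoryAtRight (τ : SLExpr) (lam : ℝ) : Prop :=
  ∃ u : ℝ → ℝ, τ.IsRealSolution lam u ∧ (∃ x ∈ τ.I, u x ≠ 0) ∧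
    ∀ c ∈ τ.I, ∃ x ∈ τ.I, c < x ∧ u x = 0

/-- `τ - lam` is non-oscillatory at `a`. -/
def NonOscillatoryAtLeft (τ : SLExpr) (lam : ℝ) : Prop := ¬ τ.OscillatoryAtLeft lam

/-- `τ - lam` is non-oscillatory at `b`. -/
def NonOscillatoryAtRight (τ : SLExpr) (lam : ℝ) : Prop := ¬ τ.OscillatoryAtRight lam

/-- The measure `r(x) dx` on `(a, b)`. -/
def weight (τ : SLExpr) : Measure ℝ :=
  (volume.restrict τ.I).withDensity (fun x => ENNReal.ofReal (τ.r x))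

/-- The complex Hilbert space `L²((a, b); r(x) dx)`. -/
abbrev L2 (τ : SLExpr) : Type := Lp ℂ 2 τ.weight

theorem isOpen_I (τ : SLExpr) : IsOpen τ.I :=
  (isOpen_Ioo (a := τ.a) (b := τ.b)).preimage continuous_coe_real_ereal

theorem uIcc_subset_I (τ : SLExpr) {x y : ℝ} (hx : x ∈ τ.I) (hy : y ∈ τ.I) : uIcc x y ⊆ τ.I := by
  have h : OrdConnected τ.I :=
    ⟨fun u hu v hv z hz => ⟨hu.1.trans_le (EReal.coe_le_coe_iff.2 hz.1),
      (EReal.coe_le_coe_iff.2 hz.2).trans_lt hv.2⟩⟩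
  exact h.uIcc_subset hx hy

theorem ae_weight {τ : SLExpr} {P : ℝ → Prop} (h : ∀ᵐ x ∂(volume.restrict τ.I), P x) :
    ∀ᵐ x ∂τ.weight, P x :=
  (withDensity_absolutelyContinuous _ _).ae_le h

theorem ACLoc.ae_differentiableAt {τ : SLExpr} {f : ℝ → ℂ} (hf : τ.ACLoc f) :
    ∀ᵐ x ∂(volume.restrict τ.I), DifferentiableAt ℝ f x := by
  refine ae_restrict_of_ae_restrict_inter_Ioo fun x y hx hy hxy => ?_
  rw [ae_restrict_iff' (τ.isOpen_I.measurableSet.inter measurableSet_Ioo)]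
  filter_upwards [(hf x hx y hy).boundedVariationOn.ae_differentiableAt_of_mem_uIcc] with z hz h
  exact hz (Icc_subset_uIcc (Ioo_subset_Icc_self h.2))

theorem ACLoc.continuousOn {τ : SLExpr} {f : ℝ → ℂ} (hf : τ.ACLoc f) : ContinuousOn f τ.I := by
  intro x hx
  obtain ⟨ε, hε, hball⟩ := Metric.isOpen_iff.1 τ.isOpen_I x hx
  have h1 : x - ε / 2 ∈ τ.I :=
    hball (by rw [Metric.mem_ball, Real.dist_eq, abs_lt]; constructor <;> linarith)
  have h2 : x + ε / 2 ∈ τ.I :=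
    hball (by rw [Metric.mem_ball, Real.dist_eq, abs_lt]; constructor <;> linarith)
  refine ((hf _ h1 _ h2).continuousOn.continuousAt ?_).continuousWithinAt
  rw [uIcc_of_le (by linarith)]
  exact Icc_mem_nhds (by linarith) (by linarith)

theorem HasQuasiDeriv.zero (τ : SLExpr) : τ.HasQuasiDeriv (0 : ℝ → ℂ) 0 := by
  have h : τ.ACLoc (0 : ℝ → ℂ) := fun x _ y _ =>
    (LipschitzWith.const (0 : ℂ)).lipschitzOnWith.absolutelyContinuousOnInterval
  exact ⟨h, h, by simp⟩

theorem HasQuasiDeriv.add {τ : SLExpr} {f f₁ g g₁ : ℝ → ℂ} (hf : τ.HasQuasiDeriv f f₁)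
    (hg : τ.HasQuasiDeriv g g₁) : τ.HasQuasiDeriv (f + g) (f₁ + g₁) := by
  refine ⟨fun x hx y hy => (hf.acLoc x hx y hy).add (hg.acLoc x hx y hy),
    fun x hx y hy => (hf.acLoc_quasi x hx y hy).add (hg.acLoc_quasi x hx y hy), ?_⟩
  filter_upwards [hf.eq_ae, hg.eq_ae, hf.acLoc.ae_differentiableAt, hg.acLoc.ae_differentiableAt]
    with x h1 h2 h3 h4
  rw [deriv_add h3 h4, Pi.add_apply, Pi.add_apply, h1, h2]
  module

theorem HasQuasiDeriv.smul {τ : SLExpr} {f f₁ : ℝ → ℂ} (c : ℂ) (hf : τ.HasQuasiDeriv f f₁) :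
    τ.HasQuasiDeriv (c • f) (c • f₁) := by
  refine ⟨fun x hx y hy => (hf.acLoc x hx y hy).const_smul c,
    fun x hx y hy => (hf.acLoc_quasi x hx y hy).const_smul c, ?_⟩
  filter_upwards [hf.eq_ae] with x h1
  rw [deriv_const_smul_field, Pi.smul_apply, Pi.smul_apply, h1]
  simp only [Complex.real_smul, smul_eq_mul]
  ring

theorem apply_add_ae {τ : SLExpr} {f f₁ g g₁ : ℝ → ℂ} (hf : τ.HasQuasiDeriv f f₁)
    (hg : τ.HasQuasiDeriv g g₁) :
    ∀ᵐ x ∂τ.weight, τ.apply (f + g) (f₁ + g₁) x = τ.apply f f₁ x + τ.apply g g₁ x := by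
  apply ae_weight
  filter_upwards [hf.acLoc_quasi.ae_differentiableAt, hg.acLoc_quasi.ae_differentiableAt]
    with x h3 h4
  simp only [apply]
  rw [deriv_add h3 h4, Pi.add_apply, Pi.add_apply]
  module

theorem apply_smul (τ : SLExpr) (c : ℂ) (f f₁ : ℝ → ℂ) (x : ℝ) :
    τ.apply (c • f) (c • f₁) x = c • τ.apply f f₁ x := by
  simp only [apply]
  rw [deriv_const_smul_field, Pi.smul_apply, Pi.smul_apply]
  simp only [Complex.real_smul, smul_eq_mul]
  ring

/-- The graph of the maximal operator: the pairs `(F, G)` in `L² × L²` such that `F` has a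
representative `f ∈ 𝔇_τ` with `G = τ f`. -/
def maxGraph (τ : SLExpr) : Submodule ℂ (τ.L2 × τ.L2) where
  carrier := {P | ∃ f f₁ : ℝ → ℂ, τ.HasQuasiDeriv f f₁ ∧
    (∀ᵐ x ∂τ.weight, P.1 x = f x) ∧ (∀ᵐ x ∂τ.weight, P.2 x = τ.apply f f₁ x)}
  zero_mem' := by
    refine ⟨0, 0, HasQuasiDeriv.zero τ, Lp.coeFn_zero _ _ _, ?_⟩
    filter_upwards [Lp.coeFn_zero ℂ 2 τ.weight] with x hx
    refine hx.trans ?_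
    simp [apply]
  add_mem' := by
    rintro P Q ⟨f, f₁, hf, hP1, hP2⟩ ⟨g, g₁, hg, hQ1, hQ2⟩
    refine ⟨f + g, f₁ + g₁, hf.add hg, ?_, ?_⟩
    · filter_upwards [Lp.coeFn_add P.1 Q.1, hP1, hQ1] with x h h1 h2
      rw [Prod.fst_add, h, Pi.add_apply, Pi.add_apply, h1, h2]
    · filter_upwards [Lp.coeFn_add P.2 Q.2, hP2, hQ2, apply_add_ae hf hg] with x h h1 h2 h3
      rw [Prod.snd_add, h, Pi.add_apply, h1, h2, h3]
  smul_mem' := by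
    rintro c P ⟨f, f₁, hf, hP1, hP2⟩
    refine ⟨c • f, c • f₁, hf.smul c, ?_, ?_⟩
    · filter_upwards [Lp.coeFn_smul c P.1, hP1] with x h h1
      rw [Prod.smul_fst, h, Pi.smul_apply, Pi.smul_apply, h1]
    · filter_upwards [Lp.coeFn_smul c P.2, hP2] with x h h1
      rw [Prod.smul_snd, h, Pi.smul_apply, h1, apply_smul]

/-- The maximal operator `T_max` in `L²((a, b); r(x) dx)`; see `graph_Tmax`. -/
def Tmax (τ : SLExpr) : τ.L2 →ₗ.[ℂ] τ.L2 := τ.maxGraph.toLinearPMap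

/-- The elements of `L²((a, b); r(x) dx)` with compact support in `(a, b)`. -/
def compactSupp (τ : SLExpr) : Submodule ℂ τ.L2 where
  carrier := {F | ∃ K : Set ℝ, IsCompact K ∧ K ⊆ τ.I ∧ ∀ᵐ x ∂τ.weight, x ∉ K → F x = 0}
  zero_mem' := by
    refine ⟨∅, isCompact_empty, empty_subset _, ?_⟩
    filter_upwards [Lp.coeFn_zero ℂ 2 τ.weight] with x hx _
    exact hx
  add_mem' := by
    rintro F G ⟨K, hK, hKI, hF⟩ ⟨L, hL, hLI, hG⟩
    refine ⟨K ∪ L, hK.union hL, union_subset hKI hLI, ?_⟩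
    filter_upwards [Lp.coeFn_add F G, hF, hG] with x h h1 h2 hx
    rw [h, Pi.add_apply, h1 (fun hk => hx (Or.inl hk)), h2 (fun hk => hx (Or.inr hk)), add_zero]
  smul_mem' := by
    rintro c F ⟨K, hK, hKI, hF⟩
    refine ⟨K, hK, hKI, ?_⟩
    filter_upwards [Lp.coeFn_smul c F, hF] with x h h1 hx
    rw [h, Pi.smul_apply, h1 hx, smul_zero]

/-- `T_0`: the restriction of `T_max` to the functions with compact support in `(a, b)`. -/
def T0 (τ : SLExpr) : τ.L2 →ₗ.[ℂ] τ.L2 := τ.Tmax.domRestrict τ.compactSupp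

/-- The minimal operator `T_min`, the closure of `T_0`. -/
def Tmin (τ : SLExpr) : τ.L2 →ₗ.[ℂ] τ.L2 := τ.T0.closure

theorem Hypothesis.ae_of_ae_weight {τ : SLExpr} (h : τ.Hypothesis) {P : ℝ → Prop}
    (hP : ∀ᵐ x ∂τ.weight, P x) : ∀ᵐ x ∂(volume.restrict τ.I), P x := by
  have h1 := (ae_withDensity_iff' h.r_meas.ennreal_ofReal).1 hP
  filter_upwards [h1, h.r_pos] with x hx hr
  exact hx (by simpa using hr)

/-- The maximal operator is well defined: `τ f` depends only on the class of `f`. -/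
theorem graph_Tmax {τ : SLExpr} (h : τ.Hypothesis) : τ.Tmax.graph = τ.maxGraph := by
  refine Submodule.toLinearPMap_graph_eq _ ?_
  rintro ⟨F, G⟩ ⟨f, f₁, hf, hF, hG⟩ hF0
  obtain rfl : F = 0 := hF0
  have hd : ∀ g : ℝ → ℂ, EqOn g 0 τ.I → EqOn (deriv g) 0 τ.I := fun g hg x hx => by
    have : g =ᶠ[nhds x] fun _ => (0 : ℂ) := Filter.eventuallyEq_of_mem (τ.isOpen_I.mem_nhds hx) hg
    rw [this.deriv_eq]; simp
  have hf0 : EqOn f 0 τ.I := by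
    refine Measure.eqOn_open_of_ae_eq (μ := volume) ?_ τ.isOpen_I hf.acLoc.continuousOn
      continuousOn_const
    refine h.ae_of_ae_weight ?_
    filter_upwards [hF, Lp.coeFn_zero ℂ 2 τ.weight] with x h1 h2
    rw [← h1]; exact h2
  have hmem : ∀ᵐ x ∂(volume.restrict τ.I), x ∈ τ.I := ae_restrict_mem τ.isOpen_I.measurableSet
  have hf1 : EqOn f₁ 0 τ.I := by
    refine Measure.eqOn_open_of_ae_eq (μ := volume) ?_ τ.isOpen_I hf.acLoc_quasi.continuousOn
      continuousOn_const
    filter_upwards [hf.eq_ae, hmem] with x h1 hx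
    rw [h1, hd f hf0 hx, hf0 hx]; simp
  refine Lp.ext ?_
  filter_upwards [hG, Lp.coeFn_zero ℂ 2 τ.weight, ae_weight hmem] with x h1 h2 hx
  rw [h2]
  refine h1.trans ?_
  simp [apply, hd f₁ hf1 hx, hf1 hx, hf0 hx]

end SLExpr

open scoped ComplexOrder in
/-- A linear operator `T` in a complex Hilbert space is bounded from below if there is a real `γ`
with `⟨u, T u⟩ ≥ γ ⟨u, u⟩` for all `u ∈ dom T`. The order on `ℂ` is the one in which `z ≤ w` means
that `w - z` is a nonnegative real number, so the inequality includes that `⟨u, T u⟩` is real. -/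
def LinearPMap.IsBoundedFromBelow {H : Type*} [NormedAddCommGroup H] [InnerProductSpace ℂ H]
    (T : H →ₗ.[ℂ] H) : Prop :=
  ∃ γ : ℝ, ∀ u : T.domain, (γ : ℂ) * inner ℂ (u : H) (u : H) ≤ inner ℂ (u : H) (T u)

end

/-!
A solution of `τ u = λ u` without zeros near an endpoint yields `φ = u^[1] / u`, which satisfies the
Riccati equation `φ' = 2 s φ + q - φ² / p - λ r`. The derivative of `re ⟪g, g^[1]⟫ - φ |g|²` then
dominates `λ r |g|² - re ⟪g, r τ g⟫`, the difference containing the square `|g^[1] - φ g|² / p`. On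
a compact middle interval the Riccati inequality `≤` has solutions for a sufficiently negative
parameter `γ`, with prescribed value at the left end and arbitrarily large value at the right end.
Gluing the three pieces gives `⟪g, T_0 g⟫ ≥ γ ⟪g, g⟫`, since at the matching points `φ` only jumps
downwards.

For `λ < γ`, variation of constants shows that `T_0 - λ` attains every compactly supported function
orthogonal to two fixed solutions of `τ u = λ u`, so its range has a finite-dimensional orthogonal
complement. Hence a symmetric extension `S` of `T_0` is such that `S - λ` has a nonnegative form on
a subspace of finite codimension in its domain, and finitely many bounded rank-one perturbations
make the form nonnegative everywhere.
-/

section SymmetricForms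

variable {𝕜 H : Type*} [RCLike 𝕜] [NormedAddCommGroup H] [InnerProductSpace 𝕜 H]

theorem mul_norm_le_norm_of_le_re_inner {γ : ℝ} {x y : H}
    (h : γ * ‖x‖ ^ 2 ≤ RCLike.re (inner 𝕜 x y)) : γ * ‖x‖ ≤ ‖y‖ := by
  rcases (norm_nonneg x).eq_or_lt with hx | hx
  · rw [← hx, mul_zero]
    exact norm_nonneg _
  · refine le_of_mul_le_mul_right ?_ hx
    calc γ * ‖x‖ * ‖x‖ = γ * ‖x‖ ^ 2 := by ring
      _ ≤ RCLike.re (inner 𝕜 x y) := h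
      _ ≤ ‖x‖ * ‖y‖ := re_inner_le_norm _ _
      _ = ‖y‖ * ‖x‖ := mul_comm _ _

/-- `A` is a symmetric operator, not necessarily densely defined. It is a linear map on a subspace
rather than a `LinearPMap`, so that its perturbations share its domain by their type. -/
def IsSymmetricOn {V : Submodule 𝕜 H} (A : V →ₗ[𝕜] H) : Prop :=
  ∀ u v : V, inner 𝕜 (A u) (v : H) = inner 𝕜 (u : H) (A v)

namespace IsSymmetricOn

variable {V : Submodule 𝕜 H} {A : V →ₗ[𝕜] H}

theorem ofReal_re_inner (hA : IsSymmetricOn A) (u : V) :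
    (RCLike.re (inner 𝕜 (u : H) (A u)) : 𝕜) = inner 𝕜 (u : H) (A u) := by
  rw [← RCLike.conj_eq_iff_re, inner_conj_symm, hA u u]

theorem re_inner_add_eq_of_apply_eq_zero (hA : IsSymmetricOn A) {v : V} (hv : A v = 0) (u : V) :
    RCLike.re (inner 𝕜 ((u + v : V) : H) (A (u + v))) = RCLike.re (inner 𝕜 (u : H) (A u)) := by
  rw [map_add, hv, add_zero, Submodule.coe_add, inner_add_left, ← hA v u, hv, inner_zero_left,
    add_zero]

/-- The rank-one perturbation annihilating a vector `v` with `⟪v, A v⟫ = -κ < 0`. -/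
theorem exists_apply_eq_zero (hA : IsSymmetricOn A) {v : V}
    (hv : RCLike.re (inner 𝕜 (v : H) (A v)) < 0) :
    ∃ B : V →ₗ[𝕜] H, IsSymmetricOn B ∧ B v = 0 ∧
      (∀ u : V, RCLike.re (inner 𝕜 (u : H) (A u)) ≤ RCLike.re (inner 𝕜 (u : H) (B u))) ∧
      ∃ M : ℝ, ∀ u : V,
        RCLike.re (inner 𝕜 (u : H) (B u)) ≤ RCLike.re (inner 𝕜 (u : H) (A u)) + M * ‖u‖ ^ 2 := by
  obtain ⟨κ, hκ⟩ : ∃ κ : ℝ, κ = -RCLike.re (inner 𝕜 (v : H) (A v)) := ⟨_, rfl⟩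
  have hκ_pos : 0 < κ := by linarith
  let B : V →ₗ[𝕜] H :=
    A + ((innerₛₗ 𝕜 (A v)).comp V.subtype).smulRight (((κ⁻¹ : ℝ) : 𝕜) • A v)
  have hB (u : V) : B u = A u + inner 𝕜 (A v) (u : H) • ((κ⁻¹ : ℝ) : 𝕜) • A v := rfl
  have inner_B (u : V) : RCLike.re (inner 𝕜 (u : H) (B u)) =
      RCLike.re (inner 𝕜 (u : H) (A u)) + κ⁻¹ * ‖inner 𝕜 (A v) (u : H)‖ ^ 2 := by
    rw [hB, inner_add_right, inner_smul_right, inner_smul_right, map_add, mul_left_comm,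
      RCLike.re_ofReal_mul, inner_mul_symm_re_eq_norm, norm_mul, norm_inner_symm (u : H), sq]
  refine ⟨B, fun u w => ?_, ?_, fun u => ?_, κ⁻¹ * ‖A v‖ ^ 2, fun u => ?_⟩
  · simp only [hB, inner_add_left, inner_add_right, inner_smul_left, inner_smul_right, hA u w,
      inner_conj_symm, RCLike.conj_ofReal]
    ring
  · have inner_v : inner 𝕜 (A v) (v : H) = ((-κ : ℝ) : 𝕜) := by
      rw [hA v v, hκ, neg_neg, hA.ofReal_re_inner]
    rw [hB, inner_v, smul_smul, ← RCLike.ofReal_mul, neg_mul, mul_inv_cancel₀ hκ_pos.ne']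
    simp
  · rw [inner_B]
    exact le_add_of_nonneg_right (by positivity)
  · rw [inner_B, mul_assoc, ← mul_pow]
    gcongr
    exact norm_inner_le_norm _ _

theorem exists_nonneg_on_sup_span (hA : IsSymmetricOn A) {D : Submodule 𝕜 V}
    (hD : ∀ u ∈ D, 0 ≤ RCLike.re (inner 𝕜 (u : H) (A u))) (w : V) :
    ∃ B : V →ₗ[𝕜] H, IsSymmetricOn B ∧
      (∀ u ∈ D ⊔ Submodule.span 𝕜 {w}, 0 ≤ RCLike.re (inner 𝕜 (u : H) (B u))) ∧
      ∃ M : ℝ, ∀ u : V,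
        RCLike.re (inner 𝕜 (u : H) (B u)) ≤ RCLike.re (inner 𝕜 (u : H) (A u)) + M * ‖u‖ ^ 2 := by
  by_cases hw : ∀ u ∈ D ⊔ Submodule.span 𝕜 {w}, 0 ≤ RCLike.re (inner 𝕜 (u : H) (A u))
  · exact ⟨A, hA, hw, 0, fun u => by simp⟩
  push Not at hw
  obtain ⟨v, hv_mem, hv⟩ := hw
  obtain ⟨B, hB, hBv, hAB, hBA⟩ := hA.exists_apply_eq_zero hv
  refine ⟨B, hB, fun u hu => ?_, hBA⟩
  obtain ⟨d₀, hd₀, _, hw₀, rfl⟩ := Submodule.mem_sup.1 hv_mem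
  obtain ⟨k₀, rfl⟩ := Submodule.mem_span_singleton.1 hw₀
  obtain ⟨d, hd, _, hw₁, rfl⟩ := Submodule.mem_sup.1 hu
  obtain ⟨k, rfl⟩ := Submodule.mem_span_singleton.1 hw₁
  have hk₀ : k₀ ≠ 0 := by
    rintro rfl
    rw [zero_smul, add_zero] at hv
    exact (hD d₀ hd₀).not_gt hv
  have hsplit : d + k • w = (d - (k / k₀) • d₀) + (k / k₀) • (d₀ + k₀ • w) := by
    rw [smul_add, smul_smul, div_mul_cancel₀ _ hk₀]
    abel
  rw [hsplit, hB.re_inner_add_eq_of_apply_eq_zero (by rw [map_smul, hBv, smul_zero])]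
  exact (hD _ (D.sub_mem hd (D.smul_mem _ hd₀))).trans (hAB _)

/-- Each rank-one perturbation enlarges the subspace of nonnegativity by one dimension, so that
finitely many of them make the form nonnegative everywhere. -/
theorem exists_re_inner_bound_of_coFG (hA : IsSymmetricOn A) {D : Submodule 𝕜 V} (hD_coFG : D.CoFG)
    (hD : ∀ u ∈ D, 0 ≤ RCLike.re (inner 𝕜 (u : H) (A u))) :
    ∃ M : ℝ, ∀ u : V, 0 ≤ RCLike.re (inner 𝕜 (u : H) (A u)) + M * ‖u‖ ^ 2 := by
  obtain ⟨C, hC⟩ := D.exists_isCompl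
  obtain ⟨S, rfl⟩ := hD_coFG.fg_of_isCompl hC
  have htop : D ⊔ Submodule.span 𝕜 (S : Set V) = ⊤ := hC.sup_eq_top
  clear hC hD_coFG
  classical
  induction S using Finset.induction_on generalizing A D with
  | empty =>
    have hD_top : D = ⊤ := by simpa using htop
    exact ⟨0, fun u => by simpa using hD u (hD_top ▸ Submodule.mem_top)⟩
  | insert w S _ ih =>
    obtain ⟨B, hB, hB_nonneg, M₁, hM₁⟩ := hA.exists_nonneg_on_sup_span hD w
    rw [Finset.coe_insert, Submodule.span_insert, ← sup_assoc] at htop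
    obtain ⟨M₂, hM₂⟩ := ih hB hB_nonneg htop
    exact ⟨M₁ + M₂, fun u => by linarith [hM₁ u, hM₂ u]⟩

theorem re_inner_nonneg_of_mem_closure (hA : IsSymmetricOn A) {W : Submodule 𝕜 V} {γ : ℝ}
    (hγ : 0 < γ) (hW : ∀ u ∈ W, γ * ‖u‖ ^ 2 ≤ RCLike.re (inner 𝕜 (u : H) (A u))) {u : V}
    (hu : A u ∈ (W.map A).topologicalClosure) : 0 ≤ RCLike.re (inner 𝕜 (u : H) (A u)) := by
  obtain ⟨y, hy_mem, hy⟩ := mem_closure_iff_seq_limit.1 hu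
  choose x hxW hxy using hy_mem
  have hlim : Filter.Tendsto (fun n => -(‖A u - y n‖ * (‖y n‖ / γ + ‖u‖))) Filter.atTop
      (nhds 0) := by
    have hsub := (tendsto_const_nhds (x := A u)).sub hy
    rw [sub_self] at hsub
    simpa using (hsub.norm.mul ((hy.norm.div_const γ).add_const ‖u‖)).neg
  refine le_of_tendsto' hlim fun n => ?_
  have hx_nonneg : 0 ≤ RCLike.re (inner 𝕜 (x n : H) (A (x n))) :=
    (by positivity : 0 ≤ γ * ‖x n‖ ^ 2).trans (hW _ (hxW n))
  have hx_norm : ‖x n‖ ≤ ‖y n‖ / γ := by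
    rw [le_div_iff₀' hγ, ← hxy]
    exact mul_norm_le_norm_of_le_re_inner (x := (x n : H)) (hW _ (hxW n))
  have hsplit : inner 𝕜 (u : H) (A u) = inner 𝕜 (x n : H) (A (x n)) +
      (inner 𝕜 (x n : H) (A (u - x n)) + inner 𝕜 (A (u - x n)) (u : H)) := by
    rw [hA (u - x n) u, map_sub, Submodule.coe_sub, inner_sub_right, inner_sub_left]
    ring
  have hcross := (abs_le.1 ((RCLike.abs_re_le_norm _).trans ((norm_add_le _ _).trans
    (add_le_add (norm_inner_le_norm (𝕜 := 𝕜) (x n : H) (A (u - x n)))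
      (norm_inner_le_norm (𝕜 := 𝕜) (A (u - x n)) (u : H)))))).1
  have hdiff : A (u - x n) = A u - y n := by rw [map_sub, hxy]
  rw [hsplit, map_add]
  calc -(‖A u - y n‖ * (‖y n‖ / γ + ‖u‖))
      ≤ -(‖A u - y n‖ * (‖x n‖ + ‖u‖)) := by gcongr
    _ = -(‖(x n : H)‖ * ‖A (u - x n)‖ + ‖A (u - x n)‖ * ‖(u : H)‖) := by
      rw [hdiff, Submodule.coe_norm, Submodule.coe_norm]
      ring
    _ ≤ _ := by linarith

theorem exists_re_inner_bound_of_le [CompleteSpace H] (hA : IsSymmetricOn A) {W : Submodule 𝕜 V}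
    {γ : ℝ} (hγ : 0 < γ) (hW : ∀ u ∈ W, γ * ‖u‖ ^ 2 ≤ RCLike.re (inner 𝕜 (u : H) (A u)))
    (hfin : FiniteDimensional 𝕜 (W.map A)ᗮ) :
    ∃ M : ℝ, ∀ u : V, 0 ≤ RCLike.re (inner 𝕜 (u : H) (A u)) + M * ‖u‖ ^ 2 := by
  refine hA.exists_re_inner_bound_of_coFG
    (D := LinearMap.ker ((W.map A)ᗮ.orthogonalProjectionOnto.toLinearMap ∘ₗ A))
    (Submodule.CoFG.ker _) fun u hu => hA.re_inner_nonneg_of_mem_closure hγ hW ?_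
  rw [← Submodule.orthogonal_orthogonal_eq_closure]
  exact Submodule.orthogonalProjectionOnto_eq_zero_iff.1 hu

end IsSymmetricOn
end SymmetricForms

section SymmetricExtensions
variable {H : Type*} [NormedAddCommGroup H] [InnerProductSpace ℂ H]

open scoped ComplexOrder in
theorem isBoundedFromBelow_of_isFormalAdjoint {T : H →ₗ.[ℂ] H} (hT : T.IsFormalAdjoint T) {γ : ℝ}
    (hγ : ∀ u : T.domain, γ * ‖u‖ ^ 2 ≤ (inner ℂ (u : H) (T u)).re) : T.IsBoundedFromBelow := by
  refine ⟨γ, fun u => ?_⟩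
  have hreal : ((inner ℂ (u : H) (T u)).re : ℂ) = inner ℂ (u : H) (T u) :=
    IsSymmetricOn.ofReal_re_inner (A := T.toFun) hT u
  rw [← hreal, inner_self_eq_norm_sq_to_K]
  change (γ : ℂ) * ((‖u‖ : ℝ) : ℂ) ^ 2 ≤ ((inner ℂ (u : H) (T u)).re : ℂ)
  rw [← Complex.ofReal_pow, ← Complex.ofReal_mul]
  exact Complex.real_le_real.2 (hγ u)

theorem isBoundedFromBelow_of_le [CompleteSpace H] {T S : H →ₗ.[ℂ] H} (hS : S.IsFormalAdjoint S)
    (hTS : T ≤ S) {γ lam : ℝ} (hlam : lam < γ)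
    (hT : ∀ u : T.domain, γ * ‖u‖ ^ 2 ≤ (inner ℂ (u : H) (T u)).re)
    (hfin : FiniteDimensional ℂ (LinearMap.range (T.toFun - (lam : ℂ) • T.domain.subtype))ᗮ) :
    S.IsBoundedFromBelow := by
  let A : S.domain →ₗ[ℂ] H := S.toFun - (lam : ℂ) • S.domain.subtype
  have re_inner_A (u : S.domain) :
      (inner ℂ (u : H) (A u)).re = (inner ℂ (u : H) (S u)).re - lam * ‖u‖ ^ 2 := by
    have : A u = S u - (lam : ℂ) • (u : H) := rfl
    rw [this, inner_sub_right, inner_smul_right, inner_self_eq_norm_sq_to_K, Complex.sub_re,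
      Complex.re_ofReal_mul]
    norm_cast
  have hA : IsSymmetricOn A := fun u v => by
    have hS_uv : inner ℂ (S u) (v : H) = inner ℂ (u : H) (S v) := hS u v
    change inner ℂ (S u - (lam : ℂ) • (u : H)) (v : H) = inner ℂ (u : H) (S v - (lam : ℂ) • (v : H))
    rw [inner_sub_left, inner_sub_right, inner_smul_left, inner_smul_right, hS_uv,
      Complex.conj_ofReal]
  have hrange : LinearMap.range (T.toFun - (lam : ℂ) • T.domain.subtype) ≤
      (T.domain.submoduleOf S.domain).map A := by
    rintro _ ⟨u, rfl⟩
    refine ⟨⟨u, hTS.1 u.2⟩, u.2, ?_⟩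
    exact congrArg (· - (lam : ℂ) • (u : H)) (hTS.2 rfl).symm
  have hA_ge (u : S.domain) (hu : u ∈ T.domain.submoduleOf S.domain) :
      (γ - lam) * ‖u‖ ^ 2 ≤ (inner ℂ (u : H) (A u)).re := by
    have hTu : T ⟨u, hu⟩ = S u := hTS.2 rfl
    rw [re_inner_A, ← hTu, sub_mul]
    exact sub_le_sub_right (hT ⟨u, hu⟩) _
  obtain ⟨M, hM⟩ := hA.exists_re_inner_bound_of_le (sub_pos.2 hlam) hA_ge
    (Submodule.finiteDimensional_of_le (Submodule.orthogonal_le hrange))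
  refine isBoundedFromBelow_of_isFormalAdjoint hS (γ := lam - M) fun u => ?_
  have hu := hM u
  rw [RCLike.re_to_complex, re_inner_A] at hu
  linarith

end SymmetricExtensions

/-- A finite-dimensional complement `M` of `ker ℓ` in `C` satisfies `C ≤ R ⊔ M`, so that `Rᗮ` meets
the subspace `Mᗮ` of finite codimension only in `0`. -/
theorem finiteDimensional_orthogonal_of_ker_le {𝕜 H F : Type*} [RCLike 𝕜] [NormedAddCommGroup H]
    [InnerProductSpace 𝕜 H] [AddCommGroup F] [Module 𝕜 F] [FiniteDimensional 𝕜 F]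
    {C R : Submodule 𝕜 H} (hC : Cᗮ = ⊥) (ℓ : C →ₗ[𝕜] F) (hℓ : ∀ x : C, ℓ x = 0 → (x : H) ∈ R) :
    FiniteDimensional 𝕜 Rᗮ := by
  obtain ⟨N, hN⟩ := (LinearMap.ker ℓ).exists_isCompl
  have : FiniteDimensional 𝕜 N := Module.Finite.iff_fg.2 ((Submodule.CoFG.ker ℓ).fg_of_isCompl hN)
  let M : Submodule 𝕜 H := N.map C.subtype
  have hM_coFG : Mᗮ.CoFG := by
    rw [← Submodule.ker_orthogonalProjectionOnto]
    exact Submodule.CoFG.ker M.orthogonalProjectionOnto.toLinearMap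
  have hC_le : C ≤ R ⊔ M := fun c hc => by
    obtain ⟨k, hk, n, hn, hkn⟩ := Submodule.mem_sup.1
      (hN.sup_eq_top ▸ Submodule.mem_top : (⟨c, hc⟩ : C) ∈ LinearMap.ker ℓ ⊔ N)
    exact Submodule.mem_sup.2 ⟨k, hℓ k hk, n, ⟨n, hn, rfl⟩, congrArg Subtype.val hkn⟩
  have hdisj : Disjoint Rᗮ Mᗮ := by
    rw [disjoint_iff, Submodule.inf_orthogonal, ← le_bot_iff, ← hC]
    exact Submodule.orthogonal_le hC_le
  exact Module.Finite.iff_fg.2 (hM_coFG.fg_of_disjoint hdisj)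

section AbsoluteContinuity

theorem absolutelyContinuousOnInterval_of_dist_le_mul {X Y : Type*} [PseudoMetricSpace X]
    [PseudoMetricSpace Y] {f : ℝ → X} {g : ℝ → Y} {a b K : ℝ}
    (hf : AbsolutelyContinuousOnInterval f a b)
    (hgf : ∀ x ∈ uIcc a b, ∀ y ∈ uIcc a b, dist (g x) (g y) ≤ K * dist (f x) (f y)) :
    AbsolutelyContinuousOnInterval g a b := by
  have hlim := Filter.Tendsto.const_mul K hf
  rw [mul_zero] at hlim
  refine squeeze_zero' (.of_forall fun P => Finset.sum_nonneg fun i _ => dist_nonneg) ?_ hlim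
  filter_upwards [Filter.mem_inf_of_right (Filter.mem_principal_self _)] with P hP
  rw [Finset.mul_sum]
  exact Finset.sum_le_sum fun i hi => hgf _ (hP.1 i hi).1 _ (hP.1 i hi).2

/-- `f` is absolutely continuous on `uIcc a b` with a.e. derivative `f'`. The integrability of `f'`,
automatic for real-valued functions, is included because it is not known a priori for vector-valued
ones. -/
structure HasACDerivOn {E : Type*} [NormedAddCommGroup E] [NormedSpace ℝ E] (f f' : ℝ → E)
    (a b : ℝ) : Prop where
  absolutelyContinuous : AbsolutelyContinuousOnInterval f a b
  intervalIntegrable : IntervalIntegrable f' volume a b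
  ae_hasDerivAt : ∀ᵐ t, t ∈ uIcc a b → HasDerivAt f (f' t) t

namespace HasACDerivOn

variable {E F : Type*} [NormedAddCommGroup E] [NormedSpace ℝ E] [NormedAddCommGroup F]
  [NormedSpace ℝ F] {f f' g g' : ℝ → E} {a b c d : ℝ}

protected theorem const (C : E) (a b : ℝ) : HasACDerivOn (fun _ => C) (fun _ => 0) a b :=
  ⟨(LipschitzWith.const C).lipschitzOnWith.absolutelyContinuousOnInterval,
    intervalIntegrable_const, .of_forall fun t _ => hasDerivAt_const t C⟩

theorem continuousOn (hf : HasACDerivOn f f' a b) : ContinuousOn f (uIcc a b) :=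
  hf.absolutelyContinuous.continuousOn

theorem mono (hf : HasACDerivOn f f' a b) (h : uIcc c d ⊆ uIcc a b) : HasACDerivOn f f' c d :=
  ⟨hf.absolutelyContinuous.mono h, hf.intervalIntegrable.mono_set h, by
    filter_upwards [hf.ae_hasDerivAt] with t ht hmem using ht (h hmem)⟩

theorem congr (hf : HasACDerivOn f f' a b) (h : ∀ᵐ t, t ∈ uIcc a b → f' t = g' t) :
    HasACDerivOn f g' a b := by
  refine ⟨hf.absolutelyContinuous, hf.intervalIntegrable.congr_ae ?_, ?_⟩
  · rw [Filter.EventuallyEq, ae_restrict_iff' measurableSet_uIoc]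
    filter_upwards [h] with t ht hmem using ht (uIoc_subset_uIcc hmem)
  · filter_upwards [hf.ae_hasDerivAt, h] with t hderiv ht hmem
    exact ht hmem ▸ hderiv hmem

protected theorem add (hf : HasACDerivOn f f' a b) (hg : HasACDerivOn g g' a b) :
    HasACDerivOn (fun t => f t + g t) (fun t => f' t + g' t) a b := by
  refine ⟨hf.absolutelyContinuous.fun_add hg.absolutelyContinuous,
    hf.intervalIntegrable.add hg.intervalIntegrable, ?_⟩
  filter_upwards [hf.ae_hasDerivAt, hg.ae_hasDerivAt] with t hft hgt hmem
  exact (hft hmem).add (hgt hmem)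

protected theorem sub (hf : HasACDerivOn f f' a b) (hg : HasACDerivOn g g' a b) :
    HasACDerivOn (fun t => f t - g t) (fun t => f' t - g' t) a b := by
  refine ⟨hf.absolutelyContinuous.fun_sub hg.absolutelyContinuous,
    hf.intervalIntegrable.sub hg.intervalIntegrable, ?_⟩
  filter_upwards [hf.ae_hasDerivAt, hg.ae_hasDerivAt] with t hft hgt hmem
  exact (hft hmem).sub (hgt hmem)

protected theorem smul {𝕜 : Type*} [NormedField 𝕜] [NormedAlgebra ℝ 𝕜] [NormedSpace 𝕜 E]
    [IsScalarTower ℝ 𝕜 E] {φ φ' : ℝ → 𝕜} (hφ : HasACDerivOn φ φ' a b)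
    (hf : HasACDerivOn f f' a b) :
    HasACDerivOn (fun t => φ t • f t) (fun t => φ t • f' t + φ' t • f t) a b := by
  refine ⟨hφ.absolutelyContinuous.smul hf.absolutelyContinuous,
    (hf.intervalIntegrable.continuousOn_smul hφ.continuousOn).add
      (hφ.intervalIntegrable.smul_continuousOn hf.continuousOn), ?_⟩
  filter_upwards [hφ.ae_hasDerivAt, hf.ae_hasDerivAt] with t hφt hft hmem
  exact (hφt hmem).smul (hft hmem)

protected theorem pow {φ φ' : ℝ → ℝ} (hφ : HasACDerivOn φ φ' a b) (n : ℕ) :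
    HasACDerivOn (fun t => φ t ^ n) (fun t => n * φ t ^ (n - 1) * φ' t) a b := by
  refine ⟨?_, ?_, ?_⟩
  · induction n with
    | zero => simpa using (HasACDerivOn.const (1 : ℝ) a b).absolutelyContinuous
    | succ n ih =>
      simp only [pow_succ]
      exact ih.mul hφ.absolutelyContinuous
  · exact hφ.intervalIntegrable.continuousOn_mul ((hφ.continuousOn.pow _).const_mul _)
  · filter_upwards [hφ.ae_hasDerivAt] with t hφt hmem using (hφt hmem).fun_pow n

theorem clm_comp (L : E →L[ℝ] F) (hf : HasACDerivOn f f' a b) :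
    HasACDerivOn (fun t => L (f t)) (fun t => L (f' t)) a b := by
  refine ⟨absolutelyContinuousOnInterval_of_dist_le_mul hf.absolutelyContinuous
    fun x _ y _ => L.lipschitz.dist_le_mul (f x) (f y),
    ⟨L.integrable_comp hf.intervalIntegrable.1, L.integrable_comp hf.intervalIntegrable.2⟩, ?_⟩
  filter_upwards [hf.ae_hasDerivAt] with t hft hmem
  exact L.hasFDerivAt.comp_hasDerivAt t (hft hmem)

protected theorem inner {𝕜 : Type*} [RCLike 𝕜] {f f' g g' : ℝ → 𝕜} (hf : HasACDerivOn f f' a b)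
    (hg : HasACDerivOn g g' a b) :
    HasACDerivOn (fun t => inner 𝕜 (f t) (g t))
      (fun t => inner 𝕜 (f t) (g' t) + inner 𝕜 (f' t) (g t)) a b := by
  simp only [RCLike.inner_apply']
  exact (hf.clm_comp (RCLike.conjCLE (K := 𝕜)).toContinuousLinearMap).smul hg

theorem norm_sq {𝕜 : Type*} [RCLike 𝕜] {f f' : ℝ → 𝕜} (hf : HasACDerivOn f f' a b) :
    HasACDerivOn (fun t => ‖f t‖ ^ 2) (fun t => 2 * RCLike.re (inner 𝕜 (f t) (f' t))) a b := by
  have h := (hf.inner hf).clm_comp (RCLike.reCLM (K := 𝕜))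
  simp only [RCLike.reCLM_apply, map_add, inner_self_eq_norm_sq] at h
  refine h.congr (.of_forall fun t _ => ?_)
  rw [inner_re_symm (f' t), two_mul]

protected theorem inv {φ φ' : ℝ → ℝ} (hφ : HasACDerivOn φ φ' a b) (h0 : ∀ t ∈ uIcc a b, φ t ≠ 0) :
    HasACDerivOn (fun t => (φ t)⁻¹) (fun t => -φ' t / φ t ^ 2) a b := by
  have hinv_cont : ContinuousOn (fun t => (φ t)⁻¹) (uIcc a b) := hφ.continuousOn.inv₀ h0
  obtain ⟨C, hC⟩ := isCompact_uIcc.exists_bound_of_continuousOn hinv_cont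
  have hC_nonneg : 0 ≤ C := (norm_nonneg _).trans (hC a left_mem_uIcc)
  refine ⟨absolutelyContinuousOnInterval_of_dist_le_mul (K := C * C) hφ.absolutelyContinuous
    fun x hx y hy => ?_, ?_, ?_⟩
  · rw [dist_inv_inv₀ (h0 x hx) (h0 y hy), div_eq_inv_mul, mul_inv, ← norm_inv, ← norm_inv]
    gcongr
    exacts [hC x hx, hC y hy]
  · simpa only [div_eq_mul_inv, ← inv_pow] using!
      hφ.intervalIntegrable.neg.mul_continuousOn (hinv_cont.pow 2)
  · filter_upwards [hφ.ae_hasDerivAt] with t hφt hmem using (hφt hmem).fun_inv (h0 t hmem)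

variable [CompleteSpace E]

theorem primitive (hg : IntervalIntegrable g volume a b) (hc : c ∈ uIcc a b) :
    HasACDerivOn (fun t => ∫ s in c..t, g s) g a b := by
  have hint {x y : ℝ} (hx : x ∈ uIcc a b) (hy : y ∈ uIcc a b) : IntervalIntegrable g volume x y :=
    hg.mono_set (uIcc_subset_uIcc hx hy)
  refine ⟨absolutelyContinuousOnInterval_of_dist_le_mul (K := 1)
    (hg.norm.absolutelyContinuousOnInterval_intervalIntegral hc) fun x hx y hy => ?_, hg, ?_⟩
  · rw [one_mul, dist_comm, dist_comm (∫ s in c..x, ‖g s‖), dist_eq_norm, Real.dist_eq,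
      intervalIntegral.integral_interval_sub_left (hint hc hy) (hint hc hx),
      intervalIntegral.integral_interval_sub_left (hint hc hy).norm (hint hc hx).norm]
    exact intervalIntegral.norm_integral_le_abs_integral_norm
  · filter_upwards [hg.ae_hasDerivAt_integral] with t ht hmem using ht hmem c hc

theorem integral_eq_sub (hf : HasACDerivOn f f' a b) : ∫ t in a..b, f' t = f b - f a := by
  have hdiff := hf.sub (primitive hf.intervalIntegrable left_mem_uIcc)
  obtain ⟨C, hC⟩ := hdiff.absolutelyContinuous.const_of_ae_hasDerivAt_zero (by
    simpa only [sub_self] using hdiff.ae_hasDerivAt)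
  have ha := hC a left_mem_uIcc
  have hb := hC b right_mem_uIcc
  rw [intervalIntegral.integral_same, sub_zero] at ha
  rw [ha, ← hb, sub_sub_cancel]

end HasACDerivOn
end AbsoluteContinuity

section LinearODE

theorem exists_uIcc_superset {J : Set ℝ} {a b c : ℝ} (ha : a ∈ J) (hb : b ∈ J) (hc : c ∈ J) :
    ∃ x ∈ J, ∃ y ∈ J, c ∈ uIcc x y ∧ uIcc a b ⊆ uIcc x y := by
  have hmin {x y : ℝ} (hx : x ∈ J) (hy : y ∈ J) : min x y ∈ J := by
    rcases min_choice x y with h | h <;> rwa [h]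
  have hmax {x y : ℝ} (hx : x ∈ J) (hy : y ∈ J) : max x y ∈ J := by
    rcases max_choice x y with h | h <;> rwa [h]
  exact ⟨min c (min a b), hmin hc (hmin ha hb), max c (max a b), hmax hc (hmax ha hb),
    Icc_subset_uIcc ⟨min_le_left _ _, le_max_left _ _⟩,
    (Icc_subset_Icc (min_le_right _ _) (le_max_right _ _)).trans Icc_subset_uIcc⟩

variable {E : Type*} [NormedAddCommGroup E] [NormedSpace ℝ E]

theorem HasACDerivOn.primitive_of_mem [CompleteSpace E] {g : ℝ → E} {J : Set ℝ}
    (hg : ∀ x ∈ J, ∀ y ∈ J, IntervalIntegrable g volume x y) {a b c : ℝ} (ha : a ∈ J) (hb : b ∈ J)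
    (hc : c ∈ J) : HasACDerivOn (fun t => ∫ s in c..t, g s) g a b := by
  obtain ⟨x, hx, y, hy, hcxy, habxy⟩ := exists_uIcc_superset ha hb hc
  exact (HasACDerivOn.primitive (hg x hx y hy) hcxy).mono habxy

theorem intervalIntegrable_clm_apply {B : ℝ → E →L[ℝ] E} {y : ℝ → E} {a b : ℝ}
    (hB : IntervalIntegrable B volume a b) (hy : ContinuousOn y (uIcc a b)) :
    IntervalIntegrable (fun t => B t (y t)) volume a b := by
  have hy_meas : AEStronglyMeasurable y (volume.restrict (uIoc a b)) :=
    (hy.mono uIoc_subset_uIcc).aestronglyMeasurable measurableSet_uIoc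
  exact (hB.norm.mul_continuousOn hy.norm).mono_fun
    ((ContinuousLinearMap.id ℝ (E →L[ℝ] E)).aestronglyMeasurable_comp₂
      hB.def'.aestronglyMeasurable hy_meas)
    (.of_forall fun t => by simpa using (B t).le_opNorm (y t))

/-- Picard iterates of the initial value problem `y' = B y`, `y x₀ = 0`, started at the constant
`e`: their sum solves `y' = B y`, `y x₀ = e`. -/
noncomputable def picardIterate (B : ℝ → E →L[ℝ] E) (x₀ : ℝ) (e : E) : ℕ → ℝ → E
  | 0 => fun _ => e
  | n + 1 => fun t => ∫ s in x₀..t, B s (picardIterate B x₀ e n s)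

theorem abs_integral_abs_primitive_pow_mul {β : ℝ → ℝ} {x₀ t : ℝ}
    (hβ : IntervalIntegrable β volume x₀ t) (hβ_nonneg : ∀ s, 0 ≤ β s) (n : ℕ) :
    |∫ s in x₀..t, |∫ v in x₀..s, β v| ^ n * β s| = |∫ v in x₀..t, β v| ^ (n + 1) / (n + 1) := by
  obtain ⟨ε, hε, hsign⟩ : ∃ ε : ℝ, |ε| = 1 ∧ ∀ s ∈ uIcc x₀ t,
      |∫ v in x₀..s, β v| = ε * ∫ v in x₀..s, β v := by
    rcases le_total x₀ t with h | h
    · refine ⟨1, abs_one, fun s hs => ?_⟩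
      rw [uIcc_of_le h] at hs
      rw [one_mul, abs_of_nonneg (intervalIntegral.integral_nonneg hs.1 fun v _ => hβ_nonneg v)]
    · refine ⟨-1, by simp, fun s hs => ?_⟩
      rw [uIcc_of_ge h] at hs
      rw [neg_one_mul, intervalIntegral.integral_symm, abs_neg, neg_neg,
        abs_of_nonneg (intervalIntegral.integral_nonneg hs.2 fun v _ => hβ_nonneg v)]
  have hpull : ∫ s in x₀..t, |∫ v in x₀..s, β v| ^ n * β s =
      ε ^ n * ∫ s in x₀..t, (∫ v in x₀..s, β v) ^ n * β s := by
    rw [← intervalIntegral.integral_const_mul]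
    refine intervalIntegral.integral_congr fun s hs => ?_
    simp only [hsign s hs, mul_pow, mul_assoc]
  have hpow := ((HasACDerivOn.primitive hβ left_mem_uIcc).pow (n + 1)).integral_eq_sub
  simp only [Nat.add_sub_cancel, mul_assoc, intervalIntegral.integral_const_mul,
    intervalIntegral.integral_same, Nat.cast_succ] at hpow
  rw [zero_pow n.succ_ne_zero, sub_zero, mul_comm, ← eq_div_iff n.cast_add_one_ne_zero] at hpow
  rw [hpull, hpow, abs_mul, abs_pow, hε, one_pow, one_mul, abs_div, abs_pow,
    abs_of_pos (n.cast_add_one_pos : (0 : ℝ) < n + 1)]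

variable {B : ℝ → E →L[ℝ] E} {x₀ : ℝ} {e : E}

theorem continuousOn_picardIterate [CompleteSpace E] {t : ℝ}
    (hB : IntervalIntegrable B volume x₀ t) (n : ℕ) :
    ContinuousOn (picardIterate B x₀ e n) (uIcc x₀ t) := by
  induction n with
  | zero => exact continuousOn_const
  | succ n ih =>
    exact (HasACDerivOn.primitive (intervalIntegrable_clm_apply hB ih) left_mem_uIcc).continuousOn

theorem norm_picardIterate_le {t : ℝ} (hB : IntervalIntegrable B volume x₀ t) (n : ℕ) :
    ‖picardIterate B x₀ e n t‖ ≤ ‖e‖ * (|∫ v in x₀..t, ‖B v‖| ^ n / n.factorial) := by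
  induction n generalizing t with
  | zero => simp [picardIterate]
  | succ n ih =>
    have hΦ : ContinuousOn (fun t => |∫ v in x₀..t, ‖B v‖| ^ n) (uIcc x₀ t) :=
      (HasACDerivOn.primitive hB.norm left_mem_uIcc).continuousOn.abs.pow n
    calc ‖picardIterate B x₀ e (n + 1) t‖
        ≤ |∫ s in x₀..t, ‖e‖ / n.factorial * (|∫ v in x₀..s, ‖B v‖| ^ n * ‖B s‖)| := by
          refine intervalIntegral.norm_integral_le_abs_of_norm_le ?_
            ((hB.norm.continuousOn_mul hΦ).const_mul _)
          refine ae_restrict_of_forall_mem measurableSet_uIoc fun s hs => ?_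
          have hsub : uIcc x₀ s ⊆ uIcc x₀ t :=
            uIcc_subset_uIcc left_mem_uIcc (uIoc_subset_uIcc hs)
          refine ((B s).le_opNorm_of_le (ih (hB.mono_set hsub))).trans_eq ?_
          ring
      _ = ‖e‖ * (|∫ v in x₀..t, ‖B v‖| ^ (n + 1) / (n + 1).factorial) := by
          rw [intervalIntegral.integral_const_mul, abs_mul, abs_of_nonneg (by positivity),
            abs_integral_abs_primitive_pow_mul hB.norm fun s => norm_nonneg (B s),
            Nat.factorial_succ]
          push_cast
          field_simp

theorem norm_picardIterate_le_of_mem_uIcc {s t : ℝ} (hB : IntervalIntegrable B volume x₀ t)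
    (hs : s ∈ uIcc x₀ t) (n : ℕ) :
    ‖picardIterate B x₀ e n s‖ ≤ ‖e‖ * (|∫ v in x₀..t, ‖B v‖| ^ n / n.factorial) := by
  have hsub : uIcc x₀ s ⊆ uIcc x₀ t := uIcc_subset_uIcc left_mem_uIcc hs
  refine (norm_picardIterate_le (hB.mono_set hsub) n).trans ?_
  gcongr ?_ * (?_ ^ _ / _)
  exact intervalIntegral.abs_integral_mono_interval (uIoc_subset_uIoc_of_uIcc_subset_uIcc hsub)
    (.of_forall fun v => norm_nonneg (B v)) hB.norm

theorem summable_picardIterate [CompleteSpace E] {s : ℝ} (hB : IntervalIntegrable B volume x₀ s) :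
    Summable fun n => picardIterate B x₀ e n s :=
  .of_norm_bounded ((Real.summable_pow_div_factorial _).mul_left _) (norm_picardIterate_le hB)

theorem continuousOn_tsum_picardIterate [CompleteSpace E] {t : ℝ}
    (hB : IntervalIntegrable B volume x₀ t) :
    ContinuousOn (fun s => ∑' n, picardIterate B x₀ e n s) (uIcc x₀ t) :=
  continuousOn_tsum (continuousOn_picardIterate hB)
    ((Real.summable_pow_div_factorial _).mul_left _)
    fun n _ hs => norm_picardIterate_le_of_mem_uIcc hB hs n

theorem tsum_picardIterate_eq [CompleteSpace E] {t : ℝ} (hB : IntervalIntegrable B volume x₀ t) :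
    ∑' n, picardIterate B x₀ e n t =
      e + ∫ s in x₀..t, B s (∑' n, picardIterate B x₀ e n s) := by
  have hsum (C : ℝ) : Summable fun n : ℕ => ‖e‖ * (C ^ n / n.factorial) :=
    (Real.summable_pow_div_factorial C).mul_left _
  have hint : HasSum (fun n => ∫ s in x₀..t, B s (picardIterate B x₀ e n s))
      (∫ s in x₀..t, B s (∑' n, picardIterate B x₀ e n s)) := by
    refine intervalIntegral.hasSum_integral_of_dominated_convergence
      (fun n s => ‖B s‖ * (‖e‖ * (|∫ v in x₀..t, ‖B v‖| ^ n / n.factorial)))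
      (fun n => (intervalIntegrable_clm_apply hB
        (continuousOn_picardIterate hB n)).def'.aestronglyMeasurable)
      (fun n => .of_forall fun s hs => (B s).le_opNorm_of_le
        (norm_picardIterate_le_of_mem_uIcc hB (uIoc_subset_uIcc hs) n))
      (.of_forall fun s _ => (hsum _).mul_left _) ?_ (.of_forall fun s hs => ?_)
    · simp_rw [tsum_mul_left]
      exact hB.norm.mul_const _
    · have hsub : uIcc x₀ s ⊆ uIcc x₀ t := uIcc_subset_uIcc left_mem_uIcc (uIoc_subset_uIcc hs)
      exact (B s).hasSum (summable_picardIterate (hB.mono_set hsub)).hasSum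
  rw [(summable_picardIterate hB).tsum_eq_zero_add, ← hint.tsum_eq]
  rfl

theorem exists_hasACDerivOn_clm_apply [CompleteSpace E] {J : Set ℝ} (hJ : J.OrdConnected)
    (hB : ∀ x ∈ J, ∀ y ∈ J, IntervalIntegrable B volume x y) (hx₀ : x₀ ∈ J) (e : E) :
    ∃ y : ℝ → E, y x₀ = e ∧
      ∀ a ∈ J, ∀ b ∈ J, HasACDerivOn y (fun t => B t (y t)) a b := by
  set Y : ℝ → E := fun t => ∑' n, picardIterate B x₀ e n t
  have hYJ : ∀ x ∈ J, ∀ y ∈ J, IntervalIntegrable (fun t => B t (Y t)) volume x y := by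
    have hfrom (x : ℝ) (hx : x ∈ J) : IntervalIntegrable (fun t => B t (Y t)) volume x₀ x :=
      intervalIntegrable_clm_apply (hB x₀ hx₀ x hx)
        (continuousOn_tsum_picardIterate (hB x₀ hx₀ x hx))
    exact fun x hx y hy => (hfrom x hx).symm.trans (hfrom y hy)
  refine ⟨fun t => e + ∫ s in x₀..t, B s (Y s), by simp, fun a ha b hb => ?_⟩
  refine ((HasACDerivOn.const e a b).add (HasACDerivOn.primitive_of_mem hYJ ha hb hx₀)).congr ?_
  refine .of_forall fun t ht => ?_
  rw [zero_add]
  exact congrArg (B t) (tsum_picardIterate_eq (hB x₀ hx₀ t (hJ.uIcc_subset ha hb ht)))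

end LinearODE

namespace SLExpr

variable {τ : SLExpr}

section Interval

theorem ordConnected_I (τ : SLExpr) : τ.I.OrdConnected :=
  ⟨fun _ hx _ hy => Icc_subset_uIcc.trans (τ.uIcc_subset_I hx hy)⟩

theorem ae_mem_I (τ : SLExpr) : ∀ᵐ t ∂(volume.restrict τ.I), t ∈ τ.I :=
  ae_restrict_mem τ.isOpen_I.measurableSet

theorem Hypothesis.nonempty_I (hτ : τ.Hypothesis) : τ.I.Nonempty := by
  obtain ⟨x, hax, hxb⟩ := EReal.lt_iff_exists_real_btwn.1 hτ.a_lt_b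
  exact ⟨x, hax, hxb⟩

theorem exists_lt_mem_I {x : ℝ} (hx : x ∈ τ.I) : ∃ y ∈ τ.I, y < x :=
  ((frequently_lt_nhds x).and_eventually (τ.isOpen_I.mem_nhds hx)).exists.imp
    fun _ h => h.symm

theorem exists_gt_mem_I {x : ℝ} (hx : x ∈ τ.I) : ∃ y ∈ τ.I, x < y :=
  ((frequently_gt_nhds x).and_eventually (τ.isOpen_I.mem_nhds hx)).exists.imp
    fun _ h => h.symm

theorem ae_uIcc {P : ℝ → Prop} (h : ∀ᵐ t ∂(volume.restrict τ.I), P t) {x y : ℝ} (hx : x ∈ τ.I)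
    (hy : y ∈ τ.I) : ∀ᵐ t, t ∈ uIcc x y → P t := by
  rw [ae_restrict_iff' τ.isOpen_I.measurableSet] at h
  filter_upwards [h] with t ht hmem using ht (τ.uIcc_subset_I hx hy hmem)

theorem ae_I_of_uIcc {P : ℝ → Prop} (h : ∀ x ∈ τ.I, ∀ y ∈ τ.I, ∀ᵐ t, t ∈ uIcc x y → P t) :
    ∀ᵐ t ∂(volume.restrict τ.I), P t := by
  refine ae_restrict_of_ae_restrict_inter_Ioo fun x y hx hy _ => ?_
  rw [ae_restrict_iff' (τ.isOpen_I.measurableSet.inter measurableSet_Ioo)]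
  filter_upwards [h x hx y hy] with t ht hmem
  exact ht (Icc_subset_uIcc (Ioo_subset_Icc_self hmem.2))

theorem continuousOn_I_of_uIcc {X : Type*} [TopologicalSpace X] {f : ℝ → X}
    (h : ∀ x ∈ τ.I, ∀ y ∈ τ.I, ContinuousOn f (uIcc x y)) : ContinuousOn f τ.I := by
  intro x hx
  obtain ⟨y, hy, hyx⟩ := exists_lt_mem_I hx
  obtain ⟨z, hz, hxz⟩ := exists_gt_mem_I hx
  refine ((h y hy z hz).continuousAt ?_).continuousWithinAt
  rw [uIcc_of_le (hyx.trans hxz).le]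
  exact Icc_mem_nhds hyx hxz

theorem intervalIntegrable_of_locallyIntegrableOn {E : Type*} [NormedAddCommGroup E] {g : ℝ → E}
    (hg : LocallyIntegrableOn g τ.I volume) {x y : ℝ} (hx : x ∈ τ.I) (hy : y ∈ τ.I) :
    IntervalIntegrable g volume x y :=
  (hg.integrableOn_compact_subset (τ.uIcc_subset_I hx hy) isCompact_uIcc).intervalIntegrable

end Interval

section FirstOrderSystem

variable {E : Type*} [NormedAddCommGroup E] [NormedSpace ℝ E]

/-- `(f, f₁)` is a locally absolutely continuous solution on `(a, b)` of the first-order system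
`f' = p⁻¹ f₁ - s f`, `f₁' = s f₁ + q f - g`, which encodes `f₁ = f^[1]` and `r • τ f = g`. The
equation `(τ - lam) f = 0` is the case `g = lam • r • f`. -/
structure IsSolution (τ : SLExpr) (f f₁ g : ℝ → E) : Prop where
  hasACDerivOn : ∀ x ∈ τ.I, ∀ y ∈ τ.I,
    HasACDerivOn f (fun t => (τ.p t)⁻¹ • f₁ t - τ.s t • f t) x y
  hasACDerivOn_quasi : ∀ x ∈ τ.I, ∀ y ∈ τ.I,
    HasACDerivOn f₁ (fun t => τ.s t • f₁ t + τ.q t • f t - g t) x y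

theorem IsSolution.continuousOn {f f₁ g : ℝ → E} (hf : τ.IsSolution f f₁ g) :
    ContinuousOn f τ.I :=
  continuousOn_I_of_uIcc fun x hx y hy => (hf.hasACDerivOn x hx y hy).continuousOn

theorem IsSolution.congr {f f₁ g h : ℝ → E} (hf : τ.IsSolution f f₁ g)
    (hgh : ∀ᵐ t ∂(volume.restrict τ.I), g t = h t) : τ.IsSolution f f₁ h := by
  refine ⟨hf.hasACDerivOn, fun x hx y hy => (hf.hasACDerivOn_quasi x hx y hy).congr ?_⟩
  filter_upwards [ae_uIcc hgh hx hy] with t ht hmem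
  rw [ht hmem]

theorem IsSolution.hasQuasiDeriv (hτ : τ.Hypothesis) {f f₁ g : ℝ → E}
    (hf : τ.IsSolution f f₁ g) : τ.HasQuasiDeriv f f₁ where
  acLoc x hx y hy := (hf.hasACDerivOn x hx y hy).absolutelyContinuous
  acLoc_quasi x hx y hy := (hf.hasACDerivOn_quasi x hx y hy).absolutelyContinuous
  eq_ae := by
    filter_upwards [ae_I_of_uIcc fun x hx y hy => (hf.hasACDerivOn x hx y hy).ae_hasDerivAt,
      hτ.p_ne] with t ht hp
    rw [ht.deriv, sub_add_cancel, smul_inv_smul₀ hp]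

theorem IsSolution.neg_deriv_add_ae_eq {f f₁ g : ℝ → E} (hf : τ.IsSolution f f₁ g) :
    ∀ᵐ t ∂(volume.restrict τ.I), -deriv f₁ t + τ.s t • f₁ t + τ.q t • f t = g t := by
  filter_upwards [ae_I_of_uIcc fun x hx y hy => (hf.hasACDerivOn_quasi x hx y hy).ae_hasDerivAt]
    with t ht
  rw [ht.deriv]
  abel

theorem HasQuasiDeriv.isSolution [FiniteDimensional ℝ E] (hτ : τ.Hypothesis) {f f₁ g : ℝ → E}
    (hf : τ.HasQuasiDeriv f f₁)
    (hg : ∀ x ∈ τ.I, ∀ y ∈ τ.I, IntervalIntegrable g volume x y)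
    (h : ∀ᵐ t ∂(volume.restrict τ.I), -deriv f₁ t + τ.s t • f₁ t + τ.q t • f t = g t) :
    τ.IsSolution f f₁ g := by
  refine ⟨fun x hx y hy => ⟨hf.acLoc x hx y hy, ?_, ?_⟩,
    fun x hx y hy => ⟨hf.acLoc_quasi x hx y hy, ?_, ?_⟩⟩
  · exact ((intervalIntegrable_of_locallyIntegrableOn hτ.p_inv_loc hx hy).smul_continuousOn
      (hf.acLoc_quasi x hx y hy).continuousOn).sub
      ((intervalIntegrable_of_locallyIntegrableOn hτ.s_loc hx hy).smul_continuousOn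
        (hf.acLoc x hx y hy).continuousOn)
  · filter_upwards [(hf.acLoc x hx y hy).boundedVariationOn.ae_differentiableAt_of_mem_uIcc,
      ae_uIcc hf.eq_ae hx hy, ae_uIcc hτ.p_ne hx hy] with t hdiff heq hp hmem
    rw [heq hmem, inv_smul_smul₀ (hp hmem), add_sub_cancel_right]
    exact (hdiff hmem).hasDerivAt
  · exact (((intervalIntegrable_of_locallyIntegrableOn hτ.s_loc hx hy).smul_continuousOn
      (hf.acLoc_quasi x hx y hy).continuousOn).add
      ((intervalIntegrable_of_locallyIntegrableOn hτ.q_loc hx hy).smul_continuousOn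
        (hf.acLoc x hx y hy).continuousOn)).sub (hg x hx y hy)
  · filter_upwards [(hf.acLoc_quasi x hx y hy).boundedVariationOn.ae_differentiableAt_of_mem_uIcc,
      ae_uIcc h hx hy] with t hdiff heq hmem
    rw [← heq hmem, show τ.s t • f₁ t + τ.q t • f t
      - (-deriv f₁ t + τ.s t • f₁ t + τ.q t • f t) = deriv f₁ t by abel]
    exact (hdiff hmem).hasDerivAt

theorem IsSolution.isRealSolution (hτ : τ.Hypothesis) {lam : ℝ} {u u₁ : ℝ → ℝ}
    (hu : τ.IsSolution u u₁ fun t => lam * (τ.r t * u t)) : τ.IsRealSolution lam u := by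
  refine ⟨u₁, hu.hasQuasiDeriv hτ, ?_⟩
  filter_upwards [hu.neg_deriv_add_ae_eq] with t ht
  simp only [smul_eq_mul] at ht
  rw [ht]
  ring

theorem exists_isSolution (hτ : τ.Hypothesis) (lam : ℝ) {x₀ : ℝ} (hx₀ : x₀ ∈ τ.I) (e₀ e₁ : ℝ) :
    ∃ u u₁ : ℝ → ℝ, τ.IsSolution u u₁ (fun t => lam * (τ.r t * u t)) ∧ u x₀ = e₀ ∧ u₁ x₀ = e₁ := by
  let fst := ContinuousLinearMap.fst ℝ ℝ ℝ
  let snd := ContinuousLinearMap.snd ℝ ℝ ℝ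
  let B : ℝ → ℝ × ℝ →L[ℝ] ℝ × ℝ := fun t =>
    (τ.p t)⁻¹ • snd.prod 0 + (τ.q t - lam * τ.r t) • ContinuousLinearMap.prod 0 fst
      + τ.s t • (-fst).prod snd
  have hB (x) (hx : x ∈ τ.I) (y) (hy : y ∈ τ.I) : IntervalIntegrable B volume x y := by
    have hint {g : ℝ → ℝ} (hg : LocallyIntegrableOn g τ.I volume) :=
      intervalIntegrable_of_locallyIntegrableOn hg hx hy
    exact (((hint hτ.p_inv_loc).smul_continuousOn continuousOn_const).add
      (((hint hτ.q_loc).sub ((hint hτ.r_loc).const_mul lam)).smul_continuousOn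
        continuousOn_const)).add ((hint hτ.s_loc).smul_continuousOn continuousOn_const)
  obtain ⟨y, hy₀, hy⟩ := exists_hasACDerivOn_clm_apply τ.ordConnected_I hB hx₀ (e₀, e₁)
  refine ⟨fun t => (y t).1, fun t => (y t).2, ⟨fun a ha b hb => ?_, fun a ha b hb => ?_⟩,
    congr_arg Prod.fst hy₀, congr_arg Prod.snd hy₀⟩
  · refine ((hy a ha b hb).clm_comp fst).congr (.of_forall fun t _ => ?_)
    simp [B, fst, snd, sub_eq_add_neg]
  · refine ((hy a ha b hb).clm_comp snd).congr (.of_forall fun t _ => ?_)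
    simp only [B, fst, snd, add_apply, smul_apply, neg_apply, zero_apply,
      ContinuousLinearMap.prod_apply, ContinuousLinearMap.coe_fst', ContinuousLinearMap.coe_snd',
      Prod.smul_mk, Prod.mk_add_mk, smul_eq_mul, mul_neg, mul_zero, add_zero, zero_add]
    ring

end FirstOrderSystem

end SLExpr

namespace SLExpr

variable {τ : SLExpr} {𝕜 : Type*} [RCLike 𝕜] {f f₁ g g₁ F G : ℝ → 𝕜} {γ x y : ℝ} {φ : ℝ → ℝ}

section LagrangeIdentity

theorem IsSolution.intervalIntegrable_right (hτ : τ.Hypothesis) (hf : τ.IsSolution f f₁ F)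
    (hx : x ∈ τ.I) (hy : y ∈ τ.I) : IntervalIntegrable F volume x y := by
  have hf_quasi := hf.hasACDerivOn_quasi x hx y hy
  refine ((((intervalIntegrable_of_locallyIntegrableOn hτ.s_loc hx hy).smul_continuousOn
      hf_quasi.continuousOn).add
    ((intervalIntegrable_of_locallyIntegrableOn hτ.q_loc hx hy).smul_continuousOn
      (hf.hasACDerivOn x hx y hy).continuousOn)).sub hf_quasi.intervalIntegrable).congr_ae
    (.of_forall fun t => ?_)
  exact sub_sub_cancel _ _

theorem IsSolution.hasACDerivOn_inner_quasi (hf : τ.IsSolution f f₁ F) (hg : τ.IsSolution g g₁ G)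
    (hx : x ∈ τ.I) (hy : y ∈ τ.I) :
    HasACDerivOn (fun t => inner 𝕜 (f t) (g₁ t))
      (fun t => (τ.p t)⁻¹ • inner 𝕜 (f₁ t) (g₁ t) + τ.q t • inner 𝕜 (f t) (g t)
        - inner 𝕜 (f t) (G t)) x y := by
  refine ((hf.hasACDerivOn x hx y hy).inner (hg.hasACDerivOn_quasi x hx y hy)).congr
    (.of_forall fun t _ => ?_)
  simp only [inner_sub_left, inner_sub_right, inner_add_right, inner_smul_left_eq_smul,
    inner_smul_right_eq_smul]
  abel

theorem IsSolution.hasACDerivOn_quasi_inner (hf : τ.IsSolution f f₁ F) (hg : τ.IsSolution g g₁ G)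
    (hx : x ∈ τ.I) (hy : y ∈ τ.I) :
    HasACDerivOn (fun t => inner 𝕜 (f₁ t) (g t))
      (fun t => (τ.p t)⁻¹ • inner 𝕜 (f₁ t) (g₁ t) + τ.q t • inner 𝕜 (f t) (g t)
        - inner 𝕜 (F t) (g t)) x y := by
  refine ((hf.hasACDerivOn_quasi x hx y hy).inner (hg.hasACDerivOn x hx y hy)).congr
    (.of_forall fun t _ => ?_)
  simp only [inner_sub_left, inner_sub_right, inner_add_left, inner_smul_left_eq_smul,
    inner_smul_right_eq_smul]
  abel

theorem IsSolution.integral_inner_sub_inner (hf : τ.IsSolution f f₁ F) (hg : τ.IsSolution g g₁ G)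
    (hx : x ∈ τ.I) (hy : y ∈ τ.I) :
    ∫ t in x..y, (inner 𝕜 (F t) (g t) - inner 𝕜 (f t) (G t)) =
      (inner 𝕜 (f y) (g₁ y) - inner 𝕜 (f₁ y) (g y))
        - (inner 𝕜 (f x) (g₁ x) - inner 𝕜 (f₁ x) (g x)) := by
  rw [← ((hf.hasACDerivOn_inner_quasi hg hx hy).sub
    (hf.hasACDerivOn_quasi_inner hg hx hy)).integral_eq_sub]
  congr with t
  abel

end LagrangeIdentity

section Riccati

/-- `φ` is absolutely continuous on `[x, y]` and satisfies there the Riccati inequality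
`φ' ≤ 2 s φ + q - φ² / p - γ r`, which is an equality for the logarithmic quasi-derivative
`u^[1] / u` of a zero-free solution of `τ u = γ u`. -/
def RiccatiLE (τ : SLExpr) (γ : ℝ) (φ : ℝ → ℝ) (x y : ℝ) : Prop :=
  ∃ φ' : ℝ → ℝ, HasACDerivOn φ φ' x y ∧ ∀ᵐ t, t ∈ uIcc x y →
    φ' t ≤ 2 * τ.s t * φ t + τ.q t - (τ.p t)⁻¹ * φ t ^ 2 - γ * τ.r t

theorem RiccatiLE.anti (hτ : τ.Hypothesis) {γ' : ℝ} (hφ : τ.RiccatiLE γ φ x y) (hx : x ∈ τ.I)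
    (hy : y ∈ τ.I) (hγ : γ' ≤ γ) : τ.RiccatiLE γ' φ x y := by
  obtain ⟨φ', hφ', hle⟩ := hφ
  refine ⟨φ', hφ', ?_⟩
  filter_upwards [hle, ae_uIcc hτ.r_pos hx hy] with t ht hr hmem
  refine (ht hmem).trans (sub_le_sub_left ?_ _)
  exact mul_le_mul_of_nonneg_right hγ (hr hmem).le

theorem IsSolution.riccatiLE {u u₁ : ℝ → ℝ}
    (hu : τ.IsSolution u u₁ fun t => γ * (τ.r t * u t)) (hx : x ∈ τ.I) (hy : y ∈ τ.I)
    (h0 : ∀ t ∈ uIcc x y, u t ≠ 0) : τ.RiccatiLE γ (fun t => u₁ t * (u t)⁻¹) x y := by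
  refine ⟨_, (hu.hasACDerivOn_quasi x hx y hy).smul ((hu.hasACDerivOn x hx y hy).inv h0),
    .of_forall fun t hmem => le_of_eq ?_⟩
  have hut := h0 t hmem
  simp only [smul_eq_mul]
  generalize (τ.p t)⁻¹ = P
  field_simp
  ring

theorem IsSolution.intervalIntegrable_sub_re_inner (hτ : τ.Hypothesis) (hg : τ.IsSolution g g₁ G)
    (γ : ℝ) (hx : x ∈ τ.I) (hy : y ∈ τ.I) :
    IntervalIntegrable (fun t => γ * (τ.r t * ‖g t‖ ^ 2) - RCLike.re (inner 𝕜 (g t) (G t)))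
      volume x y := by
  have hg' := (hg.hasACDerivOn x hx y hy).continuousOn
  have hinner : IntervalIntegrable (fun t => inner 𝕜 (g t) (G t)) volume x y := by
    simp only [RCLike.inner_apply']
    exact (hg.intervalIntegrable_right hτ hx hy).continuousOn_mul
      (RCLike.continuous_conj.comp_continuousOn hg')
  exact (((intervalIntegrable_of_locallyIntegrableOn hτ.r_loc hx hy).mul_continuousOn
    (hg'.norm.pow 2)).const_mul γ).sub ⟨hinner.1.re, hinner.2.re⟩

/-- The logarithmic substitution completes the square: the derivative of
`re ⟪g, g₁⟫ - φ ‖g‖²` exceeds the integrand on the left by at least `p⁻¹ ‖g₁ - φ g‖²`. -/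
theorem RiccatiLE.integral_le (hτ : τ.Hypothesis)
    (hp : ∀ᵐ t ∂(volume.restrict τ.I), 0 < τ.p t) (hφ : τ.RiccatiLE γ φ x y) (hx : x ∈ τ.I)
    (hy : y ∈ τ.I) (hxy : x ≤ y) (hg : τ.IsSolution g g₁ G) :
    ∫ t in x..y, (γ * (τ.r t * ‖g t‖ ^ 2) - RCLike.re (inner 𝕜 (g t) (G t))) ≤
      (RCLike.re (inner 𝕜 (g y) (g₁ y)) - φ y * ‖g y‖ ^ 2)
        - (RCLike.re (inner 𝕜 (g x) (g₁ x)) - φ x * ‖g x‖ ^ 2) := by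
  obtain ⟨φ', hφ', hle⟩ := hφ
  have hg' := hg.hasACDerivOn x hx y hy
  have hboundary := ((hg.hasACDerivOn_inner_quasi hg hx hy).clm_comp (RCLike.reCLM (K := 𝕜))).sub
    (hφ'.smul hg'.norm_sq)
  simp only [RCLike.reCLM_apply, smul_eq_mul] at hboundary
  rw [← hboundary.integral_eq_sub]
  refine intervalIntegral.integral_mono_ae_restrict hxy
    (hg.intervalIntegrable_sub_re_inner hτ γ hx hy) hboundary.intervalIntegrable ?_
  rw [Filter.EventuallyLE, ae_restrict_iff' measurableSet_Icc, ← uIcc_of_le hxy]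
  filter_upwards [hle, ae_uIcc hp hx hy] with t hric hpt hmem
  have hsq : 0 ≤ (τ.p t)⁻¹ * ‖g₁ t - φ t • g t‖ ^ 2 := by
    have := hpt hmem
    positivity
  have hφg := mul_le_mul_of_nonneg_right (hric hmem) (sq_nonneg ‖g t‖)
  rw [@norm_sub_sq 𝕜, inner_smul_right_eq_smul, RCLike.smul_re, inner_re_symm (g₁ t)] at hsq
  simp only [norm_smul, mul_pow, Real.norm_eq_abs, sq_abs, RCLike.smul_re, map_add, map_sub,
    inner_self_eq_norm_sq, inner_sub_right, inner_smul_right_eq_smul] at hsq ⊢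
  linarith

end Riccati

end SLExpr

section LargeMultiples

variable {G r : ℝ → ℝ} {c d : ℝ}

theorem tendsto_integral_posPart_sub_natCast_mul (hG : IntervalIntegrable G volume c d)
    (hr : IntervalIntegrable r volume c d) (hr_pos : ∀ᵐ t, t ∈ uIcc c d → 0 < r t) :
    Filter.Tendsto (fun n : ℕ => ∫ t in c..d, max (G t - n * r t) 0) Filter.atTop (nhds 0) := by
  suffices h : Filter.Tendsto (fun n : ℕ => ∫ t in c..d, max (G t - n * r t) 0) Filter.atTop
      (nhds (∫ _ in c..d, (0 : ℝ))) by
    rwa [intervalIntegral.integral_zero] at h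
  refine intervalIntegral.tendsto_integral_filter_of_dominated_convergence (fun t => ‖G t‖)
    (.of_forall fun n => ?_) (.of_forall fun n => ?_) hG.norm ?_
  · exact (((intervalIntegrable_iff.1 hG).sub
      ((intervalIntegrable_iff.1 hr).const_mul n)).pos_part).aestronglyMeasurable
  · filter_upwards [hr_pos] with t ht hmem
    have : 0 ≤ n * r t := mul_nonneg n.cast_nonneg (ht (uIoc_subset_uIcc hmem)).le
    rw [Real.norm_of_nonneg (le_max_right _ _)]
    exact max_le (by linarith [Real.le_norm_self (G t)]) (norm_nonneg _)
  · filter_upwards [hr_pos] with t ht hmem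
    obtain ⟨N, hN⟩ := exists_nat_ge (G t / r t)
    refine tendsto_const_nhds.congr' ?_
    filter_upwards [Filter.eventually_ge_atTop N] with n hn
    have : G t ≤ n * r t :=
      (div_le_iff₀ (ht (uIoc_subset_uIcc hmem))).1 (hN.trans (Nat.cast_le.2 hn))
    rw [max_eq_right (sub_nonpos.2 this)]

theorem exists_hasACDerivOn_le_natCast_mul_sub (hcd : c < d) (hG : IntervalIntegrable G volume c d)
    (hr : IntervalIntegrable r volume c d) (hr_pos : ∀ᵐ t, t ∈ uIcc c d → 0 < r t) (α β : ℝ) :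
    ∃ (n : ℕ) (φ φ' : ℝ → ℝ), HasACDerivOn φ φ' c d ∧ (∀ t, φ' t ≤ n * r t - G t) ∧
      (∀ t ∈ uIcc c d, |φ t| ≤ 2 * |α| + |β| + 1) ∧ φ c = α ∧ β ≤ φ d := by
  -- Up to the small error `ρ`, the slope is the constant `K` with `K * (d - c) = |α| + |β| + 1`.
  let K := (|α| + |β| + 1) / (d - c)
  have hK : K * (d - c) = |α| + |β| + 1 := div_mul_cancel₀ _ (sub_pos.2 hcd).ne'
  have hK_nonneg : 0 ≤ K := div_nonneg (by positivity) (sub_nonneg.2 hcd.le)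
  have hKG : IntervalIntegrable (fun t => K + G t) volume c d := intervalIntegrable_const.add hG
  obtain ⟨n, hn⟩ := ((tendsto_integral_posPart_sub_natCast_mul hKG hr hr_pos).eventually
    (ge_mem_nhds one_pos)).exists
  let ρ : ℝ → ℝ := fun t => max (K + G t - n * r t) 0
  have hρ_nonneg (t) : 0 ≤ ρ t := le_max_right _ _
  have hρ : IntervalIntegrable ρ volume c d := ⟨(hKG.sub (hr.const_mul n)).1.pos_part,
    (hKG.sub (hr.const_mul n)).2.pos_part⟩
  let φ : ℝ → ℝ := fun t => α + ∫ s in c..t, (K - ρ s)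
  have hφ : HasACDerivOn φ (fun t => K - ρ t) c d :=
    ((HasACDerivOn.const α c d).add (.primitive (intervalIntegrable_const.sub hρ)
      left_mem_uIcc)).congr (.of_forall fun t _ => zero_add _)
  have hφ_eq {t : ℝ} (ht : t ∈ uIcc c d) : φ t = α + (K * (t - c) - ∫ s in c..t, ρ s) := by
    simp only [φ]
    rw [intervalIntegral.integral_sub intervalIntegrable_const
      (hρ.mono_set (uIcc_subset_uIcc_left ht)), intervalIntegral.integral_const, smul_eq_mul,
      mul_comm]
  have hρ_integral {t : ℝ} (ht : t ∈ Icc c d) : 0 ≤ ∫ s in c..t, ρ s ∧ ∫ s in c..t, ρ s ≤ 1 :=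
    ⟨intervalIntegral.integral_nonneg ht.1 fun s _ => hρ_nonneg s,
      (intervalIntegral.integral_mono_interval le_rfl ht.1 ht.2 (.of_forall hρ_nonneg) hρ).trans
        hn⟩
  refine ⟨n, φ, _, hφ, fun t => ?_, fun t ht => ?_, ?_, ?_⟩
  · linarith [le_max_left (K + G t - n * r t) 0]
  · rw [hφ_eq ht]
    rw [uIcc_of_le hcd.le] at ht
    have hKt : K * (t - c) ≤ K * (d - c) := by gcongr; exact ht.2
    have hKt_nonneg : 0 ≤ K * (t - c) := mul_nonneg hK_nonneg (sub_nonneg.2 ht.1)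
    have := hρ_integral ht
    rw [abs_le]
    constructor <;> linarith [neg_abs_le α, le_abs_self α, abs_nonneg β]
  · simp [φ]
  · rw [hφ_eq right_mem_uIcc]
    linarith [(hρ_integral (right_mem_Icc.2 hcd.le)).2, neg_abs_le α, le_abs_self β]

end LargeMultiples

namespace SLExpr

variable {τ : SLExpr}

theorem RiccatiLE.of_abs_le {γ x y M : ℝ} {φ φ' : ℝ → ℝ} (hφ : HasACDerivOn φ φ' x y)
    (hM : ∀ t ∈ uIcc x y, |φ t| ≤ M)
    (hle : ∀ t, φ' t ≤ -γ * τ.r t - (M ^ 2 * ‖(τ.p t)⁻¹‖ + 2 * M * ‖τ.s t‖ + ‖τ.q t‖)) :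
    τ.RiccatiLE γ φ x y := by
  refine ⟨φ', hφ, .of_forall fun t hmem => ?_⟩
  have hp : (τ.p t)⁻¹ * φ t ^ 2 ≤ ‖(τ.p t)⁻¹‖ * M ^ 2 := by
    gcongr ?_ * ?_
    exacts [Real.le_norm_self _, sq_le_sq' (abs_le.1 (hM t hmem)).1 (abs_le.1 (hM t hmem)).2]
  have hs : |τ.s t * φ t| ≤ ‖τ.s t‖ * M := by
    rw [abs_mul]
    exact mul_le_mul_of_nonneg_left (hM t hmem) (abs_nonneg _)
  linarith [hle t, (abs_le.1 hs).1, neg_abs_le (τ.q t), Real.norm_eq_abs (τ.q t)]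

theorem exists_riccatiLE (hτ : τ.Hypothesis) {c d : ℝ} (hc : c ∈ τ.I) (hd : d ∈ τ.I) (hcd : c < d)
    (α β : ℝ) : ∃ (γ : ℝ) (φ : ℝ → ℝ), τ.RiccatiLE γ φ c d ∧ φ c = α ∧ β ≤ φ d := by
  let M : ℝ := 2 * |α| + |β| + 1
  let G : ℝ → ℝ := fun t => M ^ 2 * ‖(τ.p t)⁻¹‖ + 2 * M * ‖τ.s t‖ + ‖τ.q t‖
  have hint {g : ℝ → ℝ} (hg : LocallyIntegrableOn g τ.I volume) :=
    intervalIntegrable_of_locallyIntegrableOn hg hc hd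
  have hG : IntervalIntegrable G volume c d := (((hint hτ.p_inv_loc).norm.const_mul _).add
    ((hint hτ.s_loc).norm.const_mul _)).add (hint hτ.q_loc).norm
  obtain ⟨n, φ, φ', hφ, hle, hM, hφc, hφd⟩ := exists_hasACDerivOn_le_natCast_mul_sub hcd hG
    (hint hτ.r_loc) (ae_uIcc hτ.r_pos hc hd) α β
  refine ⟨-n, φ, .of_abs_le hφ hM fun t => ?_, hφc, hφd⟩
  rw [neg_neg]
  exact hle t

theorem NonOscillatoryAtLeft.exists_riccatiLE (hτ : τ.Hypothesis) {lam : ℝ}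
    (h : τ.NonOscillatoryAtLeft lam) : ∃ (φ : ℝ → ℝ), ∃ c ∈ τ.I,
      ∀ x ∈ τ.I, ∀ y ∈ τ.I, x < c → y < c → τ.RiccatiLE lam φ x y := by
  obtain ⟨x₀, hx₀⟩ := hτ.nonempty_I
  obtain ⟨u, u₁, hu, hux₀, -⟩ := exists_isSolution hτ lam hx₀ 1 0
  obtain ⟨c, hc, hne⟩ : ∃ c ∈ τ.I, ∀ x ∈ τ.I, x < c → u x ≠ 0 := by
    by_contra! hcon
    exact h ⟨u, hu.isRealSolution hτ, ⟨x₀, hx₀, hux₀ ▸ one_ne_zero⟩, hcon⟩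
  refine ⟨_, c, hc, fun x hx y hy hxc hyc => hu.riccatiLE hx hy fun t ht => ?_⟩
  exact hne t (τ.uIcc_subset_I hx hy ht) (ht.2.trans_lt (max_lt hxc hyc))

theorem NonOscillatoryAtRight.exists_riccatiLE (hτ : τ.Hypothesis) {lam : ℝ}
    (h : τ.NonOscillatoryAtRight lam) : ∃ (φ : ℝ → ℝ), ∃ d ∈ τ.I,
      ∀ x ∈ τ.I, ∀ y ∈ τ.I, d < x → d < y → τ.RiccatiLE lam φ x y := by
  obtain ⟨x₀, hx₀⟩ := hτ.nonempty_I
  obtain ⟨u, u₁, hu, hux₀, -⟩ := exists_isSolution hτ lam hx₀ 1 0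
  obtain ⟨d, hd, hne⟩ : ∃ d ∈ τ.I, ∀ x ∈ τ.I, d < x → u x ≠ 0 := by
    by_contra! hcon
    exact h ⟨u, hu.isRealSolution hτ, ⟨x₀, hx₀, hux₀ ▸ one_ne_zero⟩, hcon⟩
  refine ⟨_, d, hd, fun x hx y hy hdx hdy => hu.riccatiLE hx hy fun t ht => ?_⟩
  exact hne t (τ.uIcc_subset_I hx hy ht) ((lt_min hdx hdy).trans_le ht.1)

end SLExpr

namespace SLExpr

section FormBound

variable {τ : SLExpr} {𝕜 : Type*} [RCLike 𝕜]

theorem exists_integral_sub_re_inner_nonpos (hτ : τ.Hypothesis)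
    (hp : ∀ᵐ t ∂(volume.restrict τ.I), 0 < τ.p t) {lam_a lam_b : ℝ}
    (ha : τ.NonOscillatoryAtLeft lam_a) (hb : τ.NonOscillatoryAtRight lam_b) :
    ∃ γ : ℝ, ∃ c ∈ τ.I, ∃ d ∈ τ.I, ∀ x ∈ τ.I, ∀ y ∈ τ.I, x ≤ c → d ≤ y → x ≤ y ∧
      ∀ g g₁ G : ℝ → 𝕜, τ.IsSolution g g₁ G → g x = 0 → g y = 0 →
        ∫ t in x..y, (γ * (τ.r t * ‖g t‖ ^ 2) - RCLike.re (inner 𝕜 (g t) (G t))) ≤ 0 := by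
  obtain ⟨φa, c₀, hc₀, hφa⟩ := ha.exists_riccatiLE hτ
  obtain ⟨φb, d₀, hd₀, hφb⟩ := hb.exists_riccatiLE hτ
  have hmem : uIcc c₀ d₀ ⊆ τ.I := τ.uIcc_subset_I hc₀ hd₀
  obtain ⟨c, hc, hcmin⟩ := exists_lt_mem_I (hmem ⟨le_rfl, min_le_max⟩)
  obtain ⟨d, hd, hdmax⟩ := exists_gt_mem_I (hmem ⟨min_le_max, le_rfl⟩)
  have hcd : c < d := (hcmin.trans_le min_le_max).trans hdmax
  have hcc₀ : c < c₀ := hcmin.trans_le (min_le_left _ _)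
  have hd₀d : d₀ < d := (le_max_right _ _).trans_lt hdmax
  obtain ⟨γ, φ, hφ, hφc, hφd⟩ := exists_riccatiLE hτ hc hd hcd (φa c) (φb d)
  let γ₀ : ℝ := min γ (min lam_a lam_b)
  have hγ : γ₀ ≤ γ := min_le_left _ _
  have hlam_a : γ₀ ≤ lam_a := (min_le_right _ _).trans (min_le_left _ _)
  have hlam_b : γ₀ ≤ lam_b := (min_le_right _ _).trans (min_le_right _ _)
  refine ⟨γ₀, c, hc, d, hd, fun x hx y hy hxc hdy =>
    ⟨hxc.trans (hcd.le.trans hdy), fun g g₁ G hg hgx hgy => ?_⟩⟩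
  have hleft := ((hφa x hx c hc (hxc.trans_lt hcc₀) hcc₀).anti hτ hx hc hlam_a).integral_le
    hτ hp hx hc hxc hg
  have hmiddle := (hφ.anti hτ hc hd hγ).integral_le hτ hp hc hd hcd.le hg
  have hright := ((hφb d hd y hy hd₀d (hd₀d.trans_le hdy)).anti hτ hd hy hlam_b).integral_le
    hτ hp hd hy hdy hg
  have hint {v w : ℝ} (hv : v ∈ τ.I) (hw : w ∈ τ.I) :=
    hg.intervalIntegrable_sub_re_inner hτ γ₀ hv hw
  rw [← intervalIntegral.integral_add_adjacent_intervals (hint hx hc) (hint hc hy),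
    ← intervalIntegral.integral_add_adjacent_intervals (hint hc hd) (hint hd hy)]
  have hjump := mul_le_mul_of_nonneg_right hφd (sq_nonneg ‖g d‖)
  simp only [hgx, hgy, inner_zero_left, map_zero, norm_zero] at hleft hright
  rw [hφc] at hmiddle
  linarith

end FormBound

end SLExpr

namespace SLExpr

variable {τ : SLExpr}

section WeightedSpace

variable {E : Type*} [NormedAddCommGroup E] [NormedSpace ℝ E]

theorem integrable_weight_iff (hτ : τ.Hypothesis) {ψ : ℝ → E} :
    Integrable ψ τ.weight ↔ IntegrableOn (fun t => τ.r t • ψ t) τ.I volume := by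
  rw [weight, integrable_withDensity_iff_integrable_smul₀' hτ.r_meas.ennreal_ofReal
    (.of_forall fun _ => ENNReal.ofReal_lt_top)]
  refine integrable_congr ?_
  filter_upwards [hτ.r_pos] with t ht
  rw [ENNReal.toReal_ofReal ht.le]

theorem integral_weight (hτ : τ.Hypothesis) (ψ : ℝ → E) :
    ∫ t, ψ t ∂τ.weight = ∫ t in τ.I, τ.r t • ψ t := by
  rw [weight, integral_withDensity_eq_integral_toReal_smul₀ hτ.r_meas.ennreal_ofReal
    (.of_forall fun _ => ENNReal.ofReal_lt_top)]
  refine integral_congr_ae ?_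
  filter_upwards [hτ.r_pos] with t ht
  rw [ENNReal.toReal_ofReal ht.le]

theorem integral_weight_eq_intervalIntegral (hτ : τ.Hypothesis) {ψ : ℝ → E} {x y : ℝ}
    (hx : x ∈ τ.I) (hy : y ∈ τ.I) (hxy : x ≤ y)
    (hψ : ∀ᵐ t ∂(volume.restrict τ.I), t ∉ Ioc x y → ψ t = 0) :
    ∫ t, ψ t ∂τ.weight = ∫ t in x..y, τ.r t • ψ t := by
  have hI := τ.isOpen_I.measurableSet
  rw [integral_weight hτ, intervalIntegral.integral_of_le hxy]
  refine setIntegral_eq_of_subset_of_ae_sdiff_eq_zero hI.nullMeasurableSet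
    (uIoc_of_le hxy ▸ uIoc_subset_uIcc.trans (τ.uIcc_subset_I hx hy)) ?_
  filter_upwards [(ae_restrict_iff' hI).1 hψ] with t ht hmem
  rw [ht hmem.1 hmem.2, smul_zero]

theorem isFiniteMeasure_weight_restrict (hτ : τ.Hypothesis) {K : Set ℝ} (hK : IsCompact K)
    (hKI : K ⊆ τ.I) : IsFiniteMeasure (τ.weight.restrict K) := by
  refine ⟨?_⟩
  rw [Measure.restrict_apply_univ, weight, withDensity_apply _ hK.measurableSet,
    Measure.restrict_restrict hK.measurableSet, inter_eq_left.2 hKI]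
  exact (lintegral_mono fun t => Real.ofReal_le_enorm _).trans_lt
    (hτ.r_loc.integrableOn_compact_subset hKI hK).hasFiniteIntegral

theorem integrableOn_coeFn_L2 (hτ : τ.Hypothesis) (F : τ.L2) {K : Set ℝ} (hK : IsCompact K)
    (hKI : K ⊆ τ.I) : IntegrableOn F K τ.weight :=
  have := isFiniteMeasure_weight_restrict hτ hK hKI
  ((Lp.memLp F).restrict K).integrable one_le_two

theorem intervalIntegrable_smul_coeFn_L2 (hτ : τ.Hypothesis) (F : τ.L2) {x y : ℝ} (hx : x ∈ τ.I)
    (hy : y ∈ τ.I) : IntervalIntegrable (fun t => τ.r t • F t) volume x y := by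
  have hsub := τ.uIcc_subset_I hx hy
  have hF := (integrableOn_coeFn_L2 hτ F isCompact_uIcc hsub).integrable_indicator
    measurableSet_uIcc
  refine IntegrableOn.intervalIntegrable
    ((((integrable_weight_iff hτ).1 hF).mono_set hsub).congr_fun (fun t ht => ?_)
      measurableSet_uIcc)
  simp only [indicator_of_mem ht]

end WeightedSpace

section T0

theorem mem_graph_T0_iff (hτ : τ.Hypothesis) {z : τ.L2 × τ.L2} :
    z ∈ τ.T0.graph ↔ z ∈ τ.maxGraph ∧ z.1 ∈ τ.compactSupp := by
  rw [← graph_Tmax hτ, LinearPMap.mem_graph_iff, LinearPMap.mem_graph_iff]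
  constructor
  · rintro ⟨y, hy, hTy⟩
    exact ⟨⟨⟨y, y.2.2⟩, hy, hTy⟩, hy ▸ y.2.1⟩
  · rintro ⟨⟨y, hy, hTy⟩, hsupp⟩
    exact ⟨⟨y, hy.symm ▸ hsupp, y.2⟩, hy, hTy⟩

theorem exists_subset_Ioo_of_isCompact {K : Set ℝ} (hK : IsCompact K) (hKI : K ⊆ τ.I) {c d : ℝ}
    (hc : c ∈ τ.I) (hd : d ∈ τ.I) :
    ∃ x ∈ τ.I, ∃ y ∈ τ.I, x ≤ c ∧ d ≤ y ∧ K ⊆ Ioo x y := by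
  have hKcd : IsCompact (insert c (insert d K)) := (hK.insert d).insert c
  have hsub : insert c (insert d K) ⊆ τ.I := insert_subset hc (insert_subset hd hKI)
  obtain ⟨m, hm, hmin⟩ := hKcd.exists_isLeast (insert_nonempty _ _)
  obtain ⟨M, hM, hmax⟩ := hKcd.exists_isGreatest (insert_nonempty _ _)
  obtain ⟨x, hx, hxm⟩ := exists_lt_mem_I (hsub hm)
  obtain ⟨y, hy, hMy⟩ := exists_gt_mem_I (hsub hM)
  refine ⟨x, hx, y, hy, hxm.le.trans (hmin (by simp)), (hmax (by simp)).trans hMy.le,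
    fun k hk => ?_⟩
  have hk' : k ∈ insert c (insert d K) := by simp [hk]
  exact ⟨hxm.trans_le (hmin hk'), (hmax hk').trans_lt hMy⟩

theorem eqOn_zero_of_ae_weight (hτ : τ.Hypothesis) {X : Type*} [TopologicalSpace X] [T2Space X]
    [Zero X] {f : ℝ → X} {K : Set ℝ} (hK : IsClosed K) (hf : ContinuousOn f τ.I)
    (hfK : ∀ᵐ t ∂τ.weight, t ∉ K → f t = 0) : EqOn f 0 (τ.I \ K) := by
  have hopen : IsOpen (τ.I \ K) := τ.isOpen_I.sdiff hK
  refine Measure.eqOn_open_of_ae_eq (μ := volume) ?_ hopen (hf.mono sdiff_subset)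
    continuousOn_const
  have hfK' := (ae_restrict_iff' τ.isOpen_I.measurableSet).1 (hτ.ae_of_ae_weight hfK)
  rw [Filter.EventuallyEq, ae_restrict_iff' hopen.measurableSet]
  filter_upwards [hfK'] with t ht hmem using ht hmem.1 hmem.2

theorem exists_isSolution_of_mem_domain_T0 (hτ : τ.Hypothesis) (u : τ.T0.domain) {c d : ℝ}
    (hc : c ∈ τ.I) (hd : d ∈ τ.I) :
    ∃ x ∈ τ.I, ∃ y ∈ τ.I, x ≤ c ∧ d ≤ y ∧ ∃ f f₁ : ℝ → ℂ,
      τ.IsSolution f f₁ (fun t => τ.r t • τ.T0 u t) ∧ (∀ᵐ t ∂τ.weight, (u : τ.L2) t = f t) ∧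
        ∀ t ∈ τ.I, t ∉ Ioo x y → f t = 0 := by
  obtain ⟨⟨f, f₁, hf, huf, hTu⟩, K, hK, hKI, huK⟩ :=
    (mem_graph_T0_iff hτ).1 (τ.T0.mem_graph u)
  obtain ⟨x, hx, y, hy, hxc, hdy, hKxy⟩ := exists_subset_Ioo_of_isCompact hK hKI hc hd
  have hfK : EqOn f 0 (τ.I \ K) := by
    refine eqOn_zero_of_ae_weight hτ hK.isClosed hf.acLoc.continuousOn ?_
    filter_upwards [huf, huK] with t hft htK ht using hft ▸ htK ht
  refine ⟨x, hx, y, hy, hxc, hdy, f, f₁, hf.isSolution hτ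
    (fun _ hv _ hw => intervalIntegrable_smul_coeFn_L2 hτ _ hv hw) ?_, huf,
    fun t ht hmem => hfK ⟨ht, fun htK => hmem (hKxy htK)⟩⟩
  filter_upwards [hτ.ae_of_ae_weight hTu, hτ.r_pos] with t ht hr
  rw [ht, apply, smul_inv_smul₀ hr.ne']

theorem isFormalAdjoint_T0 (hτ : τ.Hypothesis) : τ.T0.IsFormalAdjoint τ.T0 := by
  intro u v
  obtain ⟨x₀, hx₀⟩ := hτ.nonempty_I
  obtain ⟨c, hc, d, hd, hcx₀, hx₀d, f, f₁, hf, huf, hf₀⟩ :=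
    exists_isSolution_of_mem_domain_T0 hτ u hx₀ hx₀
  obtain ⟨x, hx, y, hy, hxc, hdy, g, g₁, hg, hvg, hg₀⟩ :=
    exists_isSolution_of_mem_domain_T0 hτ v hc hd
  have hxy : x ≤ y := hxc.trans (hcx₀.trans (hx₀d.trans hdy))
  have hsub : Ioo c d ⊆ Ioo x y := Ioo_subset_Ioo hxc hdy
  have hf₀' : ∀ t ∈ τ.I, t ∉ Ioo x y → f t = 0 := fun t ht hmem => hf₀ t ht (mt (@hsub t) hmem)
  have hx' : x ∉ Ioo x y := left_notMem_Ioo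
  have hy' : y ∉ Ioo x y := right_notMem_Ioo
  rw [← sub_eq_zero]
  calc inner ℂ (τ.T0 u) (v : τ.L2) - inner ℂ (u : τ.L2) (τ.T0 v)
    _ = ∫ t, (inner ℂ (τ.T0 u t) (g t) - inner ℂ (f t) (τ.T0 v t)) ∂τ.weight := by
      rw [L2.inner_def, L2.inner_def, ← integral_sub (L2.integrable_inner _ _)
        (L2.integrable_inner _ _)]
      refine integral_congr_ae ?_
      filter_upwards [huf, hvg] with t hft hgt
      rw [hft, hgt]
    _ = ∫ t in x..y, (inner ℂ (τ.r t • τ.T0 u t) (g t) - inner ℂ (f t) (τ.r t • τ.T0 v t)) := by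
      rw [integral_weight_eq_intervalIntegral hτ hx hy hxy]
      · simp only [smul_sub, inner_smul_left_eq_smul, inner_smul_right_eq_smul]
      · filter_upwards [τ.ae_mem_I] with t ht hmem
        have hmem' : t ∉ Ioo x y := mt (@Ioo_subset_Ioc_self _ _ _ _ t) hmem
        rw [hf₀' t ht hmem', hg₀ t ht hmem', inner_zero_left, inner_zero_right, sub_zero]
    _ = 0 := by
      rw [hf.integral_inner_sub_inner hg hx hy, hf₀' x hx hx', hf₀' y hy hy', hg₀ x hx hx',
        hg₀ y hy hy']
      simp only [inner_zero_left, inner_zero_right, sub_zero]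

theorem exists_mul_norm_sq_le_re_inner_T0 (hτ : τ.Hypothesis)
    (hp : ∀ᵐ t ∂(volume.restrict τ.I), 0 < τ.p t) {lam_a lam_b : ℝ}
    (ha : τ.NonOscillatoryAtLeft lam_a) (hb : τ.NonOscillatoryAtRight lam_b) :
    ∃ γ : ℝ, ∀ u : τ.T0.domain, γ * ‖u‖ ^ 2 ≤ (inner ℂ (u : τ.L2) (τ.T0 u)).re := by
  obtain ⟨γ, c, hc, d, hd, hform⟩ := exists_integral_sub_re_inner_nonpos (𝕜 := ℂ) hτ hp ha hb
  refine ⟨γ, fun u => ?_⟩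
  obtain ⟨x, hx, y, hy, hxc, hdy, f, f₁, hf, huf, hf₀⟩ :=
    exists_isSolution_of_mem_domain_T0 hτ u hc hd
  obtain ⟨hxy, hform⟩ := hform x hx y hy hxc hdy
  rw [← sub_nonpos]
  refine le_of_eq_of_le ?_
    (hform f f₁ _ hf (hf₀ x hx left_notMem_Ioo) (hf₀ y hy right_notMem_Ioo))
  calc γ * ‖u‖ ^ 2 - (inner ℂ (u : τ.L2) (τ.T0 u)).re
    _ = RCLike.re (inner ℂ (u : τ.L2) (γ • (u : τ.L2) - τ.T0 u)) := by
      rw [inner_sub_right, inner_smul_right_eq_smul, map_sub, RCLike.smul_re,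
        inner_self_eq_norm_sq]
      rfl
    _ = ∫ t, (γ * ‖f t‖ ^ 2 - RCLike.re (inner ℂ (f t) (τ.T0 u t))) ∂τ.weight := by
      rw [L2.inner_def, ← integral_re (L2.integrable_inner _ _)]
      refine integral_congr_ae ?_
      filter_upwards [huf, Lp.coeFn_sub (γ • (u : τ.L2)) (τ.T0 u), Lp.coeFn_smul γ (u : τ.L2)]
        with t hft hsub hsmul
      rw [hsub, Pi.sub_apply, hsmul, Pi.smul_apply, hft, inner_sub_right,
        inner_smul_right_eq_smul, map_sub, RCLike.smul_re, inner_self_eq_norm_sq]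
    _ = ∫ t in x..y, (γ * (τ.r t * ‖f t‖ ^ 2)
          - RCLike.re (inner ℂ (f t) (τ.r t • τ.T0 u t))) := by
      rw [integral_weight_eq_intervalIntegral hτ hx hy hxy]
      · simp only [inner_smul_right_eq_smul, RCLike.smul_re, smul_eq_mul, mul_sub, mul_left_comm γ]
      · filter_upwards [τ.ae_mem_I] with t ht hmem
        rw [hf₀ t ht (mt (@Ioo_subset_Ioc_self _ _ _ _ t) hmem), inner_zero_left, norm_zero,
          map_zero, sub_zero, zero_pow two_ne_zero, mul_zero]

end T0

end SLExpr

namespace SLExpr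

variable {τ : SLExpr}

section VariationOfConstants

variable {E : Type*} [NormedAddCommGroup E] [NormedSpace ℝ E] {lam c d : ℝ}
  {u u₁ v v₁ : ℝ → ℝ}

theorem IsSolution.wronskian_eq (hu : τ.IsSolution u u₁ fun t => lam * (τ.r t * u t))
    (hv : τ.IsSolution v v₁ fun t => lam * (τ.r t * v t)) {x y : ℝ} (hx : x ∈ τ.I)
    (hy : y ∈ τ.I) : u y * v₁ y - u₁ y * v y = u x * v₁ x - u₁ x * v x := by
  have h := hu.integral_inner_sub_inner hv hx hy
  have hzero (t : ℝ) : lam * (τ.r t * u t) * v t - u t * (lam * (τ.r t * v t)) = 0 := by ring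
  simp only [Real.inner_apply, hzero, intervalIntegral.integral_zero] at h
  exact sub_eq_zero.1 h.symm

theorem IsSolution.variation_of_constants {A B h : ℝ → E}
    (hu : τ.IsSolution u u₁ fun t => lam * (τ.r t * u t))
    (hv : τ.IsSolution v v₁ fun t => lam * (τ.r t * v t))
    (hW : ∀ t ∈ τ.I, u t * v₁ t - u₁ t * v t = 1)
    (hA : ∀ x ∈ τ.I, ∀ y ∈ τ.I, HasACDerivOn A (fun t => v t • h t) x y)
    (hB : ∀ x ∈ τ.I, ∀ y ∈ τ.I, HasACDerivOn B (fun t => u t • h t) x y) :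
    τ.IsSolution (fun t => u t • A t - v t • B t) (fun t => u₁ t • A t - v₁ t • B t)
      (fun t => lam • τ.r t • (u t • A t - v t • B t) + h t) := by
  refine ⟨fun x hx y hy => ?_, fun x hx y hy => ?_⟩
  · refine (((hu.hasACDerivOn x hx y hy).smul (hA x hx y hy)).sub
      ((hv.hasACDerivOn x hx y hy).smul (hB x hx y hy))).congr (.of_forall fun t _ => ?_)
    simp only [smul_eq_mul]
    module
  · refine (((hu.hasACDerivOn_quasi x hx y hy).smul (hA x hx y hy)).sub
      ((hv.hasACDerivOn_quasi x hx y hy).smul (hB x hx y hy))).congr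
      (.of_forall fun t hmem => ?_)
    have hWt := hW t (τ.uIcc_subset_I hx hy hmem)
    simp only [smul_eq_mul]
    linear_combination (norm := module) -(hWt • h t)

theorem intervalIntegral_eq_zero_of_integral_weight_eq_zero (hτ : τ.Hypothesis) {ψ : ℝ → E}
    (hc : c ∈ τ.I) (hψ : ∀ᵐ t ∂(volume.restrict τ.I), t ∉ Ioc c d → ψ t = 0)
    (hint : ∫ t, ψ t ∂τ.weight = 0) {t : ℝ} (ht : t ∈ τ.I) (htcd : t ∉ Icc c d) :
    ∫ s in c..t, τ.r s • ψ s = 0 := by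
  rcases lt_or_ge t c with htc | hct
  · refine intervalIntegral.integral_zero_ae ?_
    filter_upwards [ae_uIcc hψ hc ht] with s hs hmem
    rw [hs (uIoc_subset_uIcc hmem) fun hs' => ?_, smul_zero]
    exact (uIoc_of_ge htc.le ▸ hmem).2.not_gt hs'.1
  · have hdt : d ≤ t := (not_le.1 fun htd => htcd ⟨hct, htd⟩).le
    rw [← integral_weight_eq_intervalIntegral hτ hc ht hct, hint]
    filter_upwards [hψ] with s hs hmem
    exact hs (mt (@Ioc_subset_Ioc_right _ _ _ _ _ hdt s) hmem)

theorem IsSolution.exists_isSolution_of_integral_eq_zero [CompleteSpace E] (hτ : τ.Hypothesis)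
    (hu : τ.IsSolution u u₁ fun t => lam * (τ.r t * u t))
    (hv : τ.IsSolution v v₁ fun t => lam * (τ.r t * v t))
    (hW : ∀ t ∈ τ.I, u t * v₁ t - u₁ t * v t = 1) {F : ℝ → E}
    (hF : ∀ x ∈ τ.I, ∀ y ∈ τ.I, IntervalIntegrable (fun t => τ.r t • F t) volume x y)
    (hc : c ∈ τ.I) (hFcd : ∀ᵐ t ∂(volume.restrict τ.I), t ∉ Ioc c d → F t = 0)
    (hFu : ∫ t, u t • F t ∂τ.weight = 0) (hFv : ∫ t, v t • F t ∂τ.weight = 0) :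
    ∃ f f₁ : ℝ → E, τ.IsSolution f f₁ (fun t => τ.r t • (lam • f t + F t)) ∧
      ∀ t ∈ τ.I, t ∉ Icc c d → f t = 0 := by
  have hprimitive {w : ℝ → ℝ} (hw : ContinuousOn w τ.I) : ∀ x ∈ τ.I, ∀ y ∈ τ.I,
      HasACDerivOn (fun t => ∫ s in c..t, w s • τ.r s • F s) (fun t => w t • τ.r t • F t) x y :=
    fun x hx y hy => HasACDerivOn.primitive_of_mem (fun x hx y hy =>
      (hF x hx y hy).continuousOn_smul (hw.mono (τ.uIcc_subset_I hx hy))) hx hy hc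
  have hsupport {w : ℝ → ℝ} (hFw : ∫ t, w t • F t ∂τ.weight = 0) {t : ℝ} (ht : t ∈ τ.I)
      (htcd : t ∉ Icc c d) : ∫ s in c..t, w s • τ.r s • F s = 0 := by
    simp only [smul_comm (w _)]
    refine intervalIntegral_eq_zero_of_integral_weight_eq_zero hτ hc ?_ hFw ht htcd
    filter_upwards [hFcd] with s hs hmem
    rw [hs hmem, smul_zero]
  refine ⟨_, _, (hu.variation_of_constants hv hW (hprimitive hv.continuousOn)
    (hprimitive hu.continuousOn)).congr (.of_forall fun t => ?_), fun t ht htcd => ?_⟩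
  · rw [smul_add, smul_comm (τ.r t) lam]
  · rw [hsupport hFv ht htcd, hsupport hFu ht htcd, smul_zero, smul_zero, sub_zero]

end VariationOfConstants

section Deficiency

theorem memLp_of_continuousOn (hτ : τ.Hypothesis) {f : ℝ → ℂ} (hf : ContinuousOn f τ.I) {K : Set ℝ}
    (hK : IsCompact K) (hKI : K ⊆ τ.I) (hf₀ : ∀ t ∈ τ.I, t ∉ K → f t = 0) :
    MemLp f 2 τ.weight := by
  have := isFiniteMeasure_weight_restrict hτ hK hKI
  obtain ⟨C, hC⟩ := hK.exists_bound_of_continuousOn (hf.mono hKI)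
  have hfK : MemLp (K.indicator f) 2 τ.weight :=
    (memLp_indicator_iff_restrict hK.measurableSet).2 <|
      .of_bound ((hf.mono hKI).aestronglyMeasurable hK.measurableSet) C
        ((ae_restrict_iff' hK.measurableSet).2 (.of_forall hC))
  refine hfK.ae_eq ?_
  filter_upwards [ae_weight τ.ae_mem_I] with t ht
  by_cases htK : t ∈ K
  · rw [indicator_of_mem htK]
  · rw [indicator_of_notMem htK, hf₀ t ht htK]

theorem mem_graph_T0_of_isSolution (hτ : τ.Hypothesis) {f f₁ : ℝ → ℂ} {U G : τ.L2}
    (hf : τ.IsSolution f f₁ fun t => τ.r t • G t) (hUf : ∀ᵐ t ∂τ.weight, U t = f t)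
    (hU : U ∈ τ.compactSupp) : (U, G) ∈ τ.T0.graph := by
  refine (mem_graph_T0_iff hτ).2 ⟨⟨f, f₁, hf.hasQuasiDeriv hτ, hUf, ae_weight ?_⟩, hU⟩
  filter_upwards [hf.neg_deriv_add_ae_eq, hτ.r_pos] with t ht hr
  rw [apply, ht, inv_smul_smul₀ hr.ne']

theorem compactSupp_orthogonal (hτ : τ.Hypothesis) : τ.compactSuppᗮ = ⊥ := by
  rw [Submodule.eq_bot_iff]
  intro G hG
  have hzero : ∀ᵐ t ∂(volume.restrict τ.I), G t = 0 := by
    refine ae_I_of_uIcc fun x hx y hy => ?_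
    have hmem : MemLp ((uIcc x y).indicator G) 2 τ.weight :=
      (Lp.memLp G).indicator measurableSet_uIcc
    have hF := hmem.coeFn_toLp
    have hF_supp : hmem.toLp ∈ τ.compactSupp := by
      refine ⟨uIcc x y, isCompact_uIcc, τ.uIcc_subset_I hx hy, ?_⟩
      filter_upwards [hF] with t ht hnot
      rw [ht, indicator_of_notMem hnot]
    have hF_self : inner ℂ (hmem.toLp) (hmem.toLp) = 0 := by
      rw [← (Submodule.mem_orthogonal _ _).1 hG _ hF_supp, L2.inner_def, L2.inner_def]
      refine integral_congr_ae ?_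
      filter_upwards [hF] with t ht
      rw [ht]
      by_cases htxy : t ∈ uIcc x y
      · rw [indicator_of_mem htxy]
      · rw [indicator_of_notMem htxy, inner_zero_left, inner_zero_left]
    have hF_zero := (Lp.eq_zero_iff_ae_eq_zero).1 (inner_self_eq_zero.1 hF_self)
    filter_upwards [ae_uIcc (hτ.ae_of_ae_weight (hF.symm.trans hF_zero)) hx hy] with t ht htxy
    rw [← indicator_of_mem htxy G]
    exact ht htxy
  exact Lp.eq_zero_iff_ae_eq_zero.2 (ae_weight hzero)

theorem integrable_smul_of_mem_compactSupp (hτ : τ.Hypothesis) {F : τ.L2}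
    (hF : F ∈ τ.compactSupp) {u : ℝ → ℝ} (hu : ContinuousOn u τ.I) :
    Integrable (fun t => u t • F t) τ.weight := by
  obtain ⟨K, hK, hKI, hFK⟩ := hF
  refine ((integrableOn_coeFn_L2 hτ F hK hKI).continuousOn_smul (hu.mono hKI)
    hK).integrable_of_ae_notMem_eq_zero ?_
  filter_upwards [hFK] with t ht hmem
  rw [ht hmem, smul_zero]

/-- The functional `F ↦ ∫ u F r dx` on the elements of `L²((a, b); r dx)` with compact support,
for `u` continuous but not necessarily square integrable. Its kernel is used to describe the range
of `T_0 - lam`. -/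
noncomputable def pairing (hτ : τ.Hypothesis) {u : ℝ → ℝ} (hu : ContinuousOn u τ.I) :
    τ.compactSupp →ₗ[ℂ] ℂ where
  toFun F := ∫ t, u t • F.1 t ∂τ.weight
  map_add' F G := by
    rw [← integral_add (integrable_smul_of_mem_compactSupp hτ F.2 hu)
      (integrable_smul_of_mem_compactSupp hτ G.2 hu)]
    refine integral_congr_ae ?_
    filter_upwards [Lp.coeFn_add F.1 G.1] with t ht
    rw [Submodule.coe_add, ht, Pi.add_apply, smul_add]
  map_smul' z F := by
    rw [RingHom.id_apply, ← integral_smul]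
    refine integral_congr_ae ?_
    filter_upwards [Lp.coeFn_smul z F.1] with t ht
    rw [Submodule.coe_smul, ht, Pi.smul_apply, smul_comm]

theorem IsSolution.mem_range_T0_sub_smul (hτ : τ.Hypothesis) {lam : ℝ} {u u₁ v v₁ : ℝ → ℝ}
    (hu : τ.IsSolution u u₁ fun t => lam * (τ.r t * u t))
    (hv : τ.IsSolution v v₁ fun t => lam * (τ.r t * v t))
    (hW : ∀ t ∈ τ.I, u t * v₁ t - u₁ t * v t = 1) {F : τ.compactSupp}
    (hFu : pairing hτ hu.continuousOn F = 0) (hFv : pairing hτ hv.continuousOn F = 0) :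
    (F : τ.L2) ∈ LinearMap.range (τ.T0.toFun - (lam : ℂ) • τ.T0.domain.subtype) := by
  obtain ⟨F, K, hK, hKI, hFK⟩ := F
  obtain ⟨x₀, hx₀⟩ := hτ.nonempty_I
  obtain ⟨c, hc, d, hd, -, -, hKcd⟩ := exists_subset_Ioo_of_isCompact hK hKI hx₀ hx₀
  obtain ⟨f, f₁, hf, hf₀⟩ := hu.exists_isSolution_of_integral_eq_zero hτ hv hW
    (fun x hx y hy => intervalIntegrable_smul_coeFn_L2 hτ F hx hy) hc (d := d) (by
      filter_upwards [hτ.ae_of_ae_weight hFK] with t ht hmem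
      exact ht fun htK => hmem (Ioo_subset_Ioc_self (hKcd htK))) hFu hFv
  have hcdI : Icc c d ⊆ τ.I := Icc_subset_uIcc.trans (τ.uIcc_subset_I hc hd)
  have hfLp : MemLp f 2 τ.weight := memLp_of_continuousOn hτ hf.continuousOn isCompact_Icc hcdI hf₀
  let U : τ.L2 := hfLp.toLp f
  have hUf : ∀ᵐ t ∂τ.weight, U t = f t := hfLp.coeFn_toLp
  have hU : U ∈ τ.compactSupp := by
    refine ⟨Icc c d, isCompact_Icc, hcdI, ?_⟩
    filter_upwards [hUf, ae_weight τ.ae_mem_I] with t ht htI hmem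
    rw [ht, hf₀ t htI hmem]
  have hU_graph : (U, (lam : ℂ) • U + F) ∈ τ.T0.graph := by
    refine mem_graph_T0_of_isSolution hτ (hf.congr ?_) hUf hU
    filter_upwards [hτ.ae_of_ae_weight hUf,
      hτ.ae_of_ae_weight (Lp.coeFn_add ((lam : ℂ) • U) F),
      hτ.ae_of_ae_weight (Lp.coeFn_smul (lam : ℂ) U)] with t hUt hadd hsmul
    rw [hadd, Pi.add_apply, hsmul, Pi.smul_apply, hUt, Complex.coe_smul]
  obtain ⟨w, hwU, hTw⟩ := LinearPMap.mem_graph_iff _ |>.1 hU_graph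
  refine ⟨w, ?_⟩
  change τ.T0 w - (lam : ℂ) • (w : τ.L2) = F
  rw [hTw, hwU, add_sub_cancel_left]

theorem finiteDimensional_orthogonal_range_T0_sub_smul (hτ : τ.Hypothesis) (lam : ℝ) :
    FiniteDimensional ℂ
      (LinearMap.range (τ.T0.toFun - (lam : ℂ) • τ.T0.domain.subtype))ᗮ := by
  obtain ⟨x₀, hx₀⟩ := hτ.nonempty_I
  obtain ⟨u, u₁, hu, hux₀, hu₁x₀⟩ := exists_isSolution hτ lam hx₀ 1 0
  obtain ⟨v, v₁, hv, hvx₀, hv₁x₀⟩ := exists_isSolution hτ lam hx₀ 0 1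
  have hW : ∀ t ∈ τ.I, u t * v₁ t - u₁ t * v t = 1 := fun t ht => by
    rw [hu.wronskian_eq hv hx₀ ht, hux₀, hu₁x₀, hvx₀, hv₁x₀, mul_one, mul_zero, sub_zero]
  exact finiteDimensional_orthogonal_of_ker_le (compactSupp_orthogonal hτ)
    ((pairing hτ hu.continuousOn).prod (pairing hτ hv.continuousOn)) fun F hF =>
      hu.mem_range_T0_sub_smul hτ hv hW (congrArg Prod.fst hF) (congrArg Prod.snd hF)

end Deficiency

end SLExpr

theorem theoremt10p8_general (τ : SLExpr) (hτ : τ.Hypothesis)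
    (hp : ∀ᵐ x ∂(MeasureTheory.volume.restrict τ.I), 0 < τ.p x)
    (lam_a lam_b : ℝ)
    (ha : τ.NonOscillatoryAtLeft lam_a) (hb : τ.NonOscillatoryAtRight lam_b) :
    τ.T0.IsBoundedFromBelow ∧
      ∀ S : τ.L2 →ₗ.[ℂ] τ.L2, S.IsFormalAdjoint S → τ.T0 ≤ S → S.IsBoundedFromBelow := by
  obtain ⟨γ, hγ⟩ := SLExpr.exists_mul_norm_sq_le_re_inner_T0 hτ hp ha hb
  refine ⟨isBoundedFromBelow_of_isFormalAdjoint (SLExpr.isFormalAdjoint_T0 hτ) hγ, fun S hS hT₀S =>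
    isBoundedFromBelow_of_le hS hT₀S (sub_one_lt γ) hγ ?_⟩
  exact SLExpr.finiteDimensional_orthogonal_range_T0_sub_smul hτ (γ - 1)

theorem theoremt10p8 (τ : SLExpr) (hτ : τ.Hypothesis)
    (hp : ∀ᵐ x ∂(MeasureTheory.volume.restrict τ.I), 0 < τ.p x)
    (lam_a lam_b : ℝ)
    (ha : τ.NonOscillatoryAtLeft lam_a) (hb : τ.NonOscillatoryAtRight lam_b) :
    τ.T0.IsBoundedFromBelow ∧
      ∀ S : τ.L2 →ₗ.[ℂ] τ.L2, IsSelfAdjoint S → τ.Tmin ≤ S → S.IsBoundedFromBelow := by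
  obtain ⟨hT₀, hext⟩ := theoremt10p8_general τ hτ hp lam_a lam_b ha hb
  refine ⟨hT₀, fun S hS hTS => hext S ?_ ((LinearPMap.le_closure τ.T0).trans hTS)⟩
  have hformal := LinearPMap.adjoint_isFormalAdjoint hS.dense_domain
  rwa [LinearPMap.isSelfAdjoint_def.1 hS] at hformal
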